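/- Work over $\mathbb{C}$. Let $t_0,t_1\in\mathbb{C}$ with $t_1\neq 0$ and $t_0\neq t_1$, i.e. $t=[t_0:t_1]\in\mathbb{P}^1\setminus\{1,\infty\}$, where $1=[1:1]$ and $\infty=[1:0]$ (the value $t=0=[0:1]$ is allowed). **The curve.** Let $C_t\subset\mathbb{P}^6$ (coordinates $y_0,\dots,y_6$) be the reduced curve that is the union of the following components, labelled by the vertices of the graph $G$ with edges 0–1, 0–8, 0–9, 1–2, 1–10, 2–34, 2–11, 34–9, 34–5, 34–10, 5–6, 5–11, 6–7, 6–9, 7–8, 7–10, 8–11 (for $t\ne 0$, $C_t$ is nodal with dual graph $G$, whose only vertex that is not trivalent is the 4-valent vertex $34$; for $t=0$ component $34$ is a pair of lines). The components are the ten lines - $0$: $y_1=y_2=y_3=y_4=y_5=0$; - $1$: $y_2=y_3=y_4=y_5=y_6=0$; - $2$: $y_3=y_4=y_5=y_6=y_0-y_1=0$; - $5$: $y_0=y_1=y_6=y_3-y_4=y_2-y_4+y_5=0$; - $6$: $y_0=y_1=y_2=y_4-y_5=y_3-y_5+y_6=0$; - $7$: $y_0=y_1=y_2=y_3=y_5-y_6=0$;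 - $8$: $y_0=y_1=y_2=y_3=y_4=0$; - $9$: $y_1=y_2=y_4=y_5=y_0+y_3+y_6=0$; - $10$: $y_0=y_2=y_3=y_5=y_6=0$; - $11$: $y_0=y_1=y_3=y_4=y_6=0$; and the plane conic - $34$: $t_0y_2y_3-t_1y_2y_4+(t_1-t_0)y_3y_4=y_5=y_6=y_1-y_2+y_4=y_0-y_2+y_3=0$. **The map $\rho$.** Consider the following basis of the space of quadrics through $C_t$, which satisfies $\sum_{i=0}^4 g_ig_{i+5}=0$: $$\begin{aligned} g_0&=-t_0y_1y_3+t_1y_0y_4,\\ g_1&=-(t_0-t_1)y_0y_3-t_1y_2y_3-(t_0-t_1)y_3^2+t_1y_2y_4+(t_0-t_1)y_3y_4-(t_0-t_1)y_3y_6,\\ g_2&=(t_0-t_1)y_1y_3+t_1y_2y_3-t_1y_2y_4,\\ g_3&=t_0y_2y_3-t_1y_2y_4-(t_0-t_1)y_3y_4+(t_0-t_1)y_3y_5,\\ g_4&=-t_1y_0y_2+t_1y_1y_2-t_1y_2y_3+t_1y_2y_4,\\ g_5&=y_2y_6,\quad g_6=y_1y_5,\quad g_7=y_0y_5+y_3y_5-y_4y_5+y_4y_6,\quad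 g_8=y_1y_6,\quad g_9=y_3y_5-y_4y_5+y_4y_6. \end{aligned}$$ Let $V=\mathbb{C}^{10}$ with the quadratic form $Q(v)=\sum_{i=0}^{4}v_iv_{i+5}$, and name its coordinate vectors $e_{-1},\dots,e_{-5},e_1,\dots,e_5$ in this order. Let $U_\infty=\langle e_1,\dots,e_5\rangle$, and let $v\in V$ act on $\Lambda U_\infty$ by the operator $\varphi_v$, linear in $v$, such that $\varphi_{e_i}$ is left wedging with $e_i$ and $\varphi_{e_{-i}}$ is the contraction dual to $e_i$. Let $S^+=\Lambda^{\mathrm{even}}U_\infty$ with basis $e_I$ in the order $I=\emptyset,12,13,14,15,23,24,25,34,35,45,1234,1235,1245,1345,2345$, and $\mathbb{P}^{15}=\mathbb{P}(S^+)$. A Lagrangian is a $5$-dimensional totally isotropic subspace $U\subset V$. A point $[s]\in\mathbb{P}^{15}$ is the half spinor of $U$ if $\varphi_u(s)=0$ for all $u\in U$. Let $\mathrm{OG}(5,10)\subset\mathbb{P}^{15}$ be the variety of half spinors of Lagrangians. For a smooth point $p$ of $C_t$ let $W_p^\perp\subset V$ be the row space of the $7\times10$ Jacobian matrix $\left(\partial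 g_j/\partial y_i(p)\right)$. **The linear space.** Let $P_t=\mathbb{P}(\operatorname{RowSpace}M_t)\subset\mathbb{P}^{15}$, where $$M_t=\left[\begin{array}{cccccccccccccccc} 0&1&1&0&0&0&0&0&0&0&0&0&0&0&0&0\\ 0&0&0&0&0&0&1&0&0&0&0&0&0&0&0&0\\ 0&0&0&0&0&0&0&0&1&0&0&0&0&0&0&0\\ t_0t_1-t_1^2&0&0&0&t_0-t_1&t_1&0&t_1&0&t_0&0&0&0&0&0&0\\ 0&0&0&0&0&1&0&1&0&0&1&0&0&0&0&0\\ 0&0&0&0&0&0&0&0&0&0&0&0&1&0&0&0\\ 0&0&0&0&0&0&0&0&0&0&0&0&0&0&1&0 \end{array}\right].$$ **Proposition.** For every smooth point $p$ of $C_t$ the space $W_p^\perp$ is a Lagrangian and has exactly one half spinor $\rho(p)\in\mathbb{P}^{15}$. The resulting map $\rho:C_t^{\mathrm{sm}}\to\mathbb{P}^{15}$ extends to an embedding (closed immersion) $\rho:C_t\to\mathbb{P}^{15}$. Moreover, $P_t$ has (projective) dimension $6$, and $$\rho(C_t)=P_t\cap\mathrm{OG}(5,10),$$ both as sets and as closed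 subschemes of $\mathbb{P}^{15}$, where $\rho(C_t)$, $P_t$ and $\mathrm{OG}(5,10)$ carry their reduced structures and the intersection is scheme-theoretic. -/

import Mathlib

noncomputable section

namespace SpinorCurve

open MvPolynomial
open scoped LinearAlgebra.Projectivization

/-! ### Projective algebraic sets over the complex numbers -/

/-- Complex projective space with `n` homogeneous coordinates, `ℙⁿ⁻¹`. -/
abbrev PSpace (n : ℕ) : Type := ℙ ℂ (Fin n → ℂ)

/-- The common zeros in projective space of a set of (homogeneous) polynomials. -/
def projZeros {n : ℕ} (S : Set (MvPolynomial (Fin n) ℂ)) : Set (PSpace n) :=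
  {p | ∀ f ∈ S, eval p.rep f = 0}

/-- Zariski closed subsets of projective space. -/
def IsProjAlgebraic {n : ℕ} (Z : Set (PSpace n)) : Prop :=
  ∃ S : Set (MvPolynomial (Fin n) ℂ), (∀ f ∈ S, ∃ d, f.IsHomogeneous d) ∧ Z = projZeros S

/-- The affine cone over a set of points of projective space (it contains the origin). -/
def affineCone {n : ℕ} (Z : Set (PSpace n)) : Set (Fin n → ℂ) :=
  {v | ∀ hv : v ≠ 0, Projectivization.mk ℂ v hv ∈ Z}

/-- The homogeneous ideal of a projective algebraic set: all polynomials that vanish on its affine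
cone. It defines the reduced scheme structure. -/
def homIdeal {n : ℕ} (Z : Set (PSpace n)) : Ideal (MvPolynomial (Fin n) ℂ) :=
  vanishingIdeal ℂ (affineCone Z)

/-- The tangent space, at (a representative of) the point `p`, of the affine cone over `Z`, that is,
the common kernel of the differentials at `p` of all polynomials in the ideal of `Z`. -/
def coneTangentSpace {n : ℕ} (Z : Set (PSpace n)) (p : PSpace n) : Submodule ℂ (Fin n → ℂ) where
  carrier := {w | ∀ f ∈ homIdeal Z, ∑ i, eval p.rep (pderiv i f) * w i = 0}
  zero_mem' := by intro f _; simp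
  add_mem' := by
    intro a b ha hb f hf
    simp only [Pi.add_apply, mul_add, Finset.sum_add_distrib, ha f hf, hb f hf, add_zero]
  smul_mem' := by
    intro c a ha f hf
    have h : ∑ i, eval p.rep (pderiv i f) * (c • a) i
        = c * ∑ i, eval p.rep (pderiv i f) * a i := by
      rw [Finset.mul_sum]
      refine Finset.sum_congr rfl fun i _ => ?_
      simp only [Pi.smul_apply, smul_eq_mul]
      ring
    rw [h, ha f hf, mul_zero]

/-- The smooth locus of a reduced projective curve `Z` (all components of dimension one): the points
where the Zariski tangent space of `Z` has dimension `1`, i.e. that of the cone has dimension `2`. -/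
def smoothLocus {n : ℕ} (Z : Set (PSpace n)) : Set (PSpace n) :=
  {p ∈ Z | Module.finrank ℂ (coneTangentSpace Z p) = 2}

/-- `f` restricts to a morphism on the projective algebraic set `Z`: near every point of `Z` it is
given by forms of one common degree without common zero at that point. (A smaller open neighbourhood
`{h ≠ 0}` is covered by multiplying all the forms by `h`.) -/
def IsMorphismOn {n m : ℕ} (Z : Set (PSpace n)) (f : PSpace n → PSpace m) : Prop :=
  ∀ p ∈ Z, ∃ (d : ℕ) (F : Fin m → MvPolynomial (Fin n) ℂ),
    (∀ i, (F i).IsHomogeneous d) ∧ (fun i => eval p.rep (F i)) ≠ 0 ∧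
    ∀ q ∈ Z, ∀ hq : (fun i => eval q.rep (F i)) ≠ 0,
      f q = Projectivization.mk ℂ (fun i => eval q.rep (F i)) hq

/-- `f` restricts to an embedding (closed immersion) of the reduced projective algebraic set `Z`:
it is a morphism on `Z`, its image is Zariski closed, and it is an isomorphism of `Z` onto its
image, i.e. it has an inverse that is a morphism on the image. -/
def IsEmbeddingOn {n m : ℕ} (Z : Set (PSpace n)) (f : PSpace n → PSpace m) : Prop :=
  IsMorphismOn Z f ∧ IsProjAlgebraic (f '' Z) ∧
    ∃ g : PSpace m → PSpace n, IsMorphismOn (f '' Z) g ∧ ∀ p ∈ Z, g (f p) = p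

/-- The saturation of a homogeneous ideal with respect to the ideal of all the variables. -/
def saturation {n : ℕ} (I : Ideal (MvPolynomial (Fin n) ℂ)) : Set (MvPolynomial (Fin n) ℂ) :=
  {f | ∃ N : ℕ, ∀ m ∈ (Ideal.span (Set.range (X : Fin n → MvPolynomial (Fin n) ℂ))) ^ N, m * f ∈ I}

/-- Two homogeneous ideals define the same closed subscheme of projective space. -/
def SameSubscheme {n : ℕ} (I J : Ideal (MvPolynomial (Fin n) ℂ)) : Prop :=
  saturation I = saturation J

/-! ### Spinors and the orthogonal Grassmannian `OG(5,10)` -/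

/-- The quadratic space `V = ℂ¹⁰`. The first five coordinate vectors are the basis
`e₋₁, …, e₋₅` of the Lagrangian `U₀`, the last five are the basis `e₁, …, e₅` of `U_∞`. -/
abbrev QSpace : Type := Fin 10 → ℂ

/-- The Lagrangian `U_∞`, with its standard basis `e₁, …, e₅`. -/
abbrev UInf : Type := Fin 5 → ℂ

/-- The quadratic form `Q(v) = ∑ vᵢ vᵢ₊₅`. -/
def quadForm (v : QSpace) : ℂ := ∑ i : Fin 5, v (Fin.castAdd 5 i) * v (Fin.natAdd 5 i)

/-- The five-dimensional totally isotropic subspaces of `V`. -/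
def IsLagrangian (U : Submodule ℂ QSpace) : Prop :=
  Module.finrank ℂ U = 5 ∧ ∀ u ∈ U, quadForm u = 0

/-- The action `φ_v` of `v ∈ V` on `Λ U_∞`: `e₋ᵢ` acts by contraction and `eᵢ` by left wedging. -/
def cliffordAction (v : QSpace) :
    ExteriorAlgebra ℂ UInf →ₗ[ℂ] ExteriorAlgebra ℂ UInf :=
  CliffordAlgebra.contractLeft (Q := (0 : QuadraticForm ℂ UInf))
      (∑ i : Fin 5, v (Fin.castAdd 5 i) • (LinearMap.proj i : UInf →ₗ[ℂ] ℂ)) +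
    LinearMap.mulLeft ℂ (ExteriorAlgebra.ι ℂ (fun i : Fin 5 => v (Fin.natAdd 5 i)))

/-- The index sets of the basis `e_I` of `S⁺ = Λ^even U_∞`, in the order
`∅, 12, 13, 14, 15, 23, 24, 25, 34, 35, 45, 1234, 1235, 1245, 1345, 2345`
(`eᵢ` has index `i - 1` in `Fin 5`). -/
def evenIndex : Fin 16 → List (Fin 5) :=
  ![[], [0, 1], [0, 2], [0, 3], [0, 4], [1, 2], [1, 3], [1, 4], [2, 3], [2, 4], [3, 4],
    [0, 1, 2, 3], [0, 1, 2, 4], [0, 1, 3, 4], [0, 2, 3, 4], [1, 2, 3, 4]]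

/-- `e_I`, the wedge product of the `eᵢ` for `i` in the increasing list `I`. -/
def wedgeBasis (I : List (Fin 5)) : ExteriorAlgebra ℂ UInf :=
  (I.map fun i => ExteriorAlgebra.ι ℂ (Pi.single i (1 : ℂ) : UInf)).prod

/-- The even spinor `∑ x_I e_I` with coordinates `x`. -/
def evenSpinor (x : Fin 16 → ℂ) : ExteriorAlgebra ℂ UInf :=
  ∑ k : Fin 16, x k • wedgeBasis (evenIndex k)

/-- The point `x` of `ℙ(S⁺) = ℙ¹⁵` is the class of a half spinor of `U`. -/
def IsHalfSpinor (U : Submodule ℂ QSpace) (x : PSpace 16) : Prop :=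
  ∀ u ∈ U, cliffordAction u (evenSpinor x.rep) = 0

/-- The orthogonal Grassmannian in `ℙ(S⁺)`: the classes of the half spinors of the Lagrangians
(of the family whose half spinors are even). -/
def OG : Set (PSpace 16) :=
  {x | ∃ U : Submodule ℂ QSpace, IsLagrangian U ∧ IsHalfSpinor U x}

/-! ### The nodal curves and their spinor map -/

/-- Homogeneous equations in `ℙ⁶` of the irreducible components of the curve with parameter
`t = [t₀ : t₁]`, in the order of the vertices `0, 1, 2, 34, 5, 6, 7, 8, 9, 10, 11` of the dual
graph. All are lines, except the conic with label `34` (for `t₀ = 0` a pair of lines). -/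
def componentEqs (t₀ t₁ : ℂ) : Fin 11 → Set (MvPolynomial (Fin 7) ℂ) :=
  ![{X 5, X 4, X 3, X 2, X 1},
    {X 6, X 5, X 4, X 3, X 2},
    {X 6, X 5, X 4, X 3, X 0 - X 1},
    {C t₀ * X 2 * X 3 - C t₁ * X 2 * X 4 + C (-t₀ + t₁) * X 3 * X 4,
      X 6, X 5, X 1 - X 2 + X 4, X 0 - X 2 + X 3},
    {X 6, X 3 - X 4, X 2 - X 4 + X 5, X 1, X 0},
    {X 4 - X 5, X 3 - X 5 + X 6, X 2, X 1, X 0},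
    {X 5 - X 6, X 3, X 2, X 1, X 0},
    {X 4, X 3, X 2, X 1, X 0},
    {X 5, X 4, X 2, X 1, X 0 + X 3 + X 6},
    {X 6, X 5, X 3, X 2, X 0},
    {X 6, X 4, X 3, X 1, X 0}]

/-- The curve `C_t` in `ℙ⁶`, the union of its components (with the reduced structure). -/
def nodalCurve (t₀ t₁ : ℂ) : Set (PSpace 7) :=
  ⋃ v : Fin 11, projZeros (componentEqs t₀ t₁ v)

/-- The basis `g₀, …, g₉` of the quadrics through the curve, with `∑ gᵢ gᵢ₊₅ = 0`. -/
def quadric (t₀ t₁ : ℂ) : Fin 10 → MvPolynomial (Fin 7) ℂ :=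
  ![-C t₀ * X 1 * X 3 + C t₁ * X 0 * X 4,
    -C (t₀ - t₁) * X 0 * X 3 - C t₁ * X 2 * X 3 - C (t₀ - t₁) * X 3 ^ 2 + C t₁ * X 2 * X 4
      + C (t₀ - t₁) * X 3 * X 4 - C (t₀ - t₁) * X 3 * X 6,
    C (t₀ - t₁) * X 1 * X 3 + C t₁ * X 2 * X 3 - C t₁ * X 2 * X 4,
    C t₀ * X 2 * X 3 - C t₁ * X 2 * X 4 - C (t₀ - t₁) * X 3 * X 4 + C (t₀ - t₁) * X 3 * X 5,
    -C t₁ * X 0 * X 2 + C t₁ * X 1 * X 2 - C t₁ * X 2 * X 3 + C t₁ * X 2 * X 4,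
    X 2 * X 6,
    X 1 * X 5,
    X 0 * X 5 + X 3 * X 5 - X 4 * X 5 + X 4 * X 6,
    X 1 * X 6,
    X 3 * X 5 - X 4 * X 5 + X 4 * X 6]

/-- `W_p^⊥`: the row space of the `7 × 10` Jacobian matrix `(∂g_j / ∂y_i (p))`. -/
def jacobianRowSpace (t₀ t₁ : ℂ) (p : PSpace 7) : Submodule ℂ QSpace :=
  Submodule.span ℂ (Set.range fun (i : Fin 7) (j : Fin 10) =>
    eval p.rep (pderiv i (quadric t₀ t₁ j)))

/-- The matrix `M_t`; the columns are the coordinates `x_I` in the order of `evenIndex`. -/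
def spinorMatrix (t₀ t₁ : ℂ) : Matrix (Fin 7) (Fin 16) ℂ :=
  !![0, 1, 1, 0, 0, 0, 0, 0, 0, 0, 0, 0, 0, 0, 0, 0;
     0, 0, 0, 0, 0, 0, 1, 0, 0, 0, 0, 0, 0, 0, 0, 0;
     0, 0, 0, 0, 0, 0, 0, 0, 1, 0, 0, 0, 0, 0, 0, 0;
     t₀ * t₁ - t₁ ^ 2, 0, 0, 0, t₀ - t₁, t₁, 0, t₁, 0, t₀, 0, 0, 0, 0, 0, 0;
     0, 0, 0, 0, 0, 1, 0, 1, 0, 0, 1, 0, 0, 0, 0, 0;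
     0, 0, 0, 0, 0, 0, 0, 0, 0, 0, 0, 0, 1, 0, 0, 0;
     0, 0, 0, 0, 0, 0, 0, 0, 0, 0, 0, 0, 0, 0, 1, 0]

/-- The linear subspace `P_t = ℙ(RowSpace M_t)` of `ℙ¹⁵`. -/
def spinorPlane (t₀ t₁ : ℂ) : Set (PSpace 16) :=
  ((Submodule.span ℂ (Set.range (spinorMatrix t₀ t₁).row)).projectivization : Set (PSpace 16))

end SpinorCurve

end

noncomputable section

namespace SpinorCurve

open MvPolynomial
open scoped LinearAlgebra.Projectivization

/-! Let β be the symmetric bilinear map `vectorForm` from even spinors to V, put q(x) = β(x, x), and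
let L be the linear map `spinorLift`, which is injective with image the row space of M_t. Everything
rests on the polynomial identity q(L y) = -2 t₁ (g₀(y), …, g₉(y)) of `vectorForm_spinorLift`. The
map ρ is the projectivization of L, hence a linear embedding.

Half spinors. By polarization, row i of the Jacobian at p is a nonzero multiple of β(L p, L eᵢ).
When q(x) = 0, every β(x, y) annihilates x, so L p is annihilated by W_p^⊥, and W_p^⊥ is isotropic
because φ_v² = Q(v). At a smooth point the cone has a tangent space of dimension 2, so the Jacobian
has rank 7 - 2 = 5. The half spinor is unique because each further independent isotropic vector
halves the space of annihilated spinors: 32 / 2⁵ = 1.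

The orthogonal Grassmannian is the zero set of q (`mk_mem_OG_iff`). For a pure spinor, q vanishes by
the adjointness of the Clifford action. Conversely, if q(x) = 0, a dimension count shows that the
annihilator of x is Lagrangian. So L identifies the zeros of the quadrics with P_t ∩ OG.

The ideal of the curve. Both the tangent spaces and the scheme structure require that the quadrics
generate the full homogeneous ideal of C_t (`homIdeal_nodalCurve`). This is proved by residuation: a
linear form h splits a union of components into the part A inside h = 0 and the residual part B, and
generators for A and B yield generators for A ∪ B (`mem_idealOf_of_residual`). The outermost cut is
y₆ = 0, with the pentagon 0, 6, 7, 8, 9 as residual curve.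

Scheme structure. Pulling a form back along L and then along the projection `spinorProj` changes it
only by an element of the ideal of P_t, and the pulled back gⱼ agree with equations of OG modulo
that ideal. Hence I(ρ(C_t)) = I(P_t) + I(OG), even without saturation (`homIdeal_image_spinorMap`).
-/

/-! ### The Clifford action in coordinates -/

/-- The index sets of the basis of `Λ^odd U_∞`. -/
def oddIndex : Fin 16 → List (Fin 5) :=
  ![[0], [1], [2], [3], [4], [0, 1, 2], [0, 1, 3], [0, 1, 4], [0, 2, 3], [0, 2, 4], [0, 3, 4],
    [1, 2, 3], [1, 2, 4], [1, 3, 4], [2, 3, 4], [0, 1, 2, 3, 4]]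

/-- The odd spinor with coordinates `y`. -/
def oddSpinor (y : Fin 16 → ℂ) : ExteriorAlgebra ℂ UInf :=
  ∑ k : Fin 16, y k • wedgeBasis (oddIndex k)

/-- The Clifford action of `v` on even spinors, in coordinates. -/
def evenAction (v : QSpace) (x : Fin 16 → ℂ) : Fin 16 → ℂ :=
  ![v 5 * x 0 - v 1 * x 1 - v 2 * x 2 - v 3 * x 3 - v 4 * x 4,
     v 0 * x 1 + v 6 * x 0 - v 2 * x 5 - v 3 * x 6 - v 4 * x 7,
     v 0 * x 2 + v 1 * x 5 + v 7 * x 0 - v 3 * x 8 - v 4 * x 9,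
     v 0 * x 3 + v 1 * x 6 + v 2 * x 8 + v 8 * x 0 - v 4 * x 10,
     v 0 * x 4 + v 1 * x 7 + v 2 * x 9 + v 3 * x 10 + v 9 * x 0,
     v 5 * x 5 - v 6 * x 2 + v 7 * x 1 - v 3 * x 11 - v 4 * x 12,
     v 5 * x 6 - v 6 * x 3 + v 2 * x 11 + v 8 * x 1 - v 4 * x 13,
     v 5 * x 7 - v 6 * x 4 + v 2 * x 12 + v 3 * x 13 + v 9 * x 1,
     v 5 * x 8 - v 1 * x 11 - v 7 * x 3 + v 8 * x 2 - v 4 * x 14,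
     v 5 * x 9 - v 1 * x 12 - v 7 * x 4 + v 3 * x 14 + v 9 * x 2,
     v 5 * x 10 - v 1 * x 13 - v 2 * x 14 - v 8 * x 4 + v 9 * x 3,
     v 0 * x 11 + v 6 * x 8 - v 7 * x 6 + v 8 * x 5 - v 4 * x 15,
     v 0 * x 12 + v 6 * x 9 - v 7 * x 7 + v 3 * x 15 + v 9 * x 5,
     v 0 * x 13 + v 6 * x 10 - v 2 * x 15 - v 8 * x 7 + v 9 * x 6,
     v 0 * x 14 + v 1 * x 15 + v 7 * x 10 - v 8 * x 9 + v 9 * x 8,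
     v 5 * x 15 - v 6 * x 14 + v 7 * x 13 - v 8 * x 12 + v 9 * x 11]

/-- The Clifford action of `v` on odd spinors, in coordinates. -/
def oddAction (v : QSpace) (y : Fin 16 → ℂ) : Fin 16 → ℂ :=
  ![v 0 * y 0 + v 1 * y 1 + v 2 * y 2 + v 3 * y 3 + v 4 * y 4,
     v 5 * y 1 - v 6 * y 0 + v 2 * y 5 + v 3 * y 6 + v 4 * y 7,
     v 5 * y 2 - v 1 * y 5 - v 7 * y 0 + v 3 * y 8 + v 4 * y 9,
     v 5 * y 3 - v 1 * y 6 - v 2 * y 8 - v 8 * y 0 + v 4 * y 10,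
     v 5 * y 4 - v 1 * y 7 - v 2 * y 9 - v 3 * y 10 - v 9 * y 0,
     v 0 * y 5 + v 6 * y 2 - v 7 * y 1 + v 3 * y 11 + v 4 * y 12,
     v 0 * y 6 + v 6 * y 3 - v 2 * y 11 - v 8 * y 1 + v 4 * y 13,
     v 0 * y 7 + v 6 * y 4 - v 2 * y 12 - v 3 * y 13 - v 9 * y 1,
     v 0 * y 8 + v 1 * y 11 + v 7 * y 3 - v 8 * y 2 + v 4 * y 14,
     v 0 * y 9 + v 1 * y 12 + v 7 * y 4 - v 3 * y 14 - v 9 * y 2,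
     v 0 * y 10 + v 1 * y 13 + v 2 * y 14 + v 8 * y 4 - v 9 * y 3,
     v 5 * y 11 - v 6 * y 8 + v 7 * y 6 - v 8 * y 5 + v 4 * y 15,
     v 5 * y 12 - v 6 * y 9 + v 7 * y 7 - v 3 * y 15 - v 9 * y 5,
     v 5 * y 13 - v 6 * y 10 + v 2 * y 15 + v 8 * y 7 - v 9 * y 6,
     v 5 * y 14 - v 1 * y 15 - v 7 * y 10 + v 8 * y 9 - v 9 * y 8,
     v 0 * y 15 + v 6 * y 14 - v 7 * y 13 + v 8 * y 12 - v 9 * y 11]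

/-- The generators of the exterior algebra. -/
def gen (i : Fin 5) : ExteriorAlgebra ℂ UInf := ExteriorAlgebra.ι ℂ (Pi.single i (1 : ℂ) : UInf)

/-- Contraction with a dual basis vector. -/
def contr (i : Fin 5) : ExteriorAlgebra ℂ UInf →ₗ[ℂ] ExteriorAlgebra ℂ UInf :=
  CliffordAlgebra.contractLeft (Q := (0 : QuadraticForm ℂ UInf))
    (LinearMap.proj i : UInf →ₗ[ℂ] ℂ)

theorem contr_gen_mul (i j : Fin 5) (z : ExteriorAlgebra ℂ UInf) :
    contr i (gen j * z) = (if i = j then z else 0) - gen j * contr i z := by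
  unfold contr gen
  erw [CliffordAlgebra.contractLeft_ι_mul]
  by_cases h : i = j
  · subst h; simp
  · simp [h]

theorem contr_gen (i j : Fin 5) : contr i (gen j) = if i = j then 1 else 0 := by
  unfold contr gen
  erw [CliffordAlgebra.contractLeft_ι]
  by_cases h : i = j
  · subst h; simp
  · simp [h]

theorem contr_one (i : Fin 5) : contr i 1 = 0 := by
  unfold contr; exact CliffordAlgebra.contractLeft_one (Q := (0 : QuadraticForm ℂ UInf)) _

theorem gen_mul_self (i : Fin 5) : gen i * gen i = 0 := ExteriorAlgebra.ι_sq_zero _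

theorem gen_mul_self_mul (i : Fin 5) (z : ExteriorAlgebra ℂ UInf) : gen i * (gen i * z) = 0 := by
  rw [← mul_assoc, gen_mul_self, zero_mul]

/-- As a rewrite rule, this sorts products of generators into increasing order; the side condition
keeps the rewriting from looping. -/
theorem gen_mul_gen {i j : Fin 5} (_ : j < i) : gen i * gen j = - (gen j * gen i) :=
  eq_neg_of_add_eq_zero_left (CliffordAlgebra.ι_mul_ι_add_swap_of_isOrtho (by simp
      [QuadraticMap.IsOrtho]))

theorem gen_mul_gen_mul {i j : Fin 5} (h : j < i) (z : ExteriorAlgebra ℂ UInf) :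
    gen i * (gen j * z) = - (gen j * (gen i * z)) := by
  rw [← mul_assoc, gen_mul_gen h, neg_mul, mul_assoc]

theorem cliffordAction_apply (v : QSpace) (z : ExteriorAlgebra ℂ UInf) :
    cliffordAction v z = v 0 • contr 0 z + v 1 • contr 1 z + v 2 • contr 2 z + v 3 • contr 3 z
      + v 4 • contr 4 z + v 5 • (gen 0 * z) + v 6 • (gen 1 * z) + v 7 • (gen 2 * z)
      + v 8 • (gen 3 * z) + v 9 • (gen 4 * z) := by
  have h : (fun i : Fin 5 => v (Fin.natAdd 5 i)) =
      ∑ i : Fin 5, v (Fin.natAdd 5 i) • (Pi.single i (1 : ℂ) : UInf) := by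
    ext j; simp [Finset.sum_apply, Pi.single_apply]
  unfold cliffordAction
  rw [h]
  simp only [Fin.sum_univ_five, map_add, map_smul, LinearMap.add_apply, LinearMap.smul_apply,
    LinearMap.mulLeft_apply, add_mul, smul_mul_assoc]
  unfold contr gen
  simp only [← add_assoc]
  rfl

theorem eq_sum_smul_single {n : ℕ} {E : Type*} [AddCommGroup E] [Module ℂ E] (g : (Fin n → ℂ) → E)
    (hadd : ∀ x y, g (x + y) = g x + g y) (hsmul : ∀ (a : ℂ) x, g (a • x) = a • g x)
    (x : Fin n → ℂ) : g x = ∑ k, x k • g (Pi.single k 1) := by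
  let f : (Fin n → ℂ) →ₗ[ℂ] E := { toFun := g, map_add' := hadd, map_smul' := hsmul }
  have h : f x = _ := f.pi_apply_eq_sum_univ x
  refine h.trans (Finset.sum_congr rfl fun k _ => congrArg (fun z => x k • g z) ?_)
  ext j
  simp [Pi.single_apply, eq_comm]

theorem evenAction_add (v : QSpace) (x y : Fin 16 → ℂ) :
    evenAction v (x + y) = evenAction v x + evenAction v y := by
  simp only [evenAction, Pi.add_apply, Matrix.cons_add_cons, Matrix.empty_add_empty]
  iterate 16 refine Matrix.vecCons_inj.2 ⟨by ring, ?_⟩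
  rfl

theorem evenAction_smul (v : QSpace) (a : ℂ) (x : Fin 16 → ℂ) :
    evenAction v (a • x) = a • evenAction v x := by
  simp only [evenAction, Pi.smul_apply, smul_eq_mul, Matrix.smul_cons, Matrix.smul_empty, mul_add,
    mul_sub, mul_left_comm a]

theorem evenAction_eq_sum (v : QSpace) (x : Fin 16 → ℂ) :
    evenAction v x = ∑ k, x k • evenAction v (Pi.single k 1) :=
  eq_sum_smul_single _ (evenAction_add v) (evenAction_smul v) x

theorem oddAction_add (v : QSpace) (x y : Fin 16 → ℂ) :
    oddAction v (x + y) = oddAction v x + oddAction v y := by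
  simp only [oddAction, Pi.add_apply, Matrix.cons_add_cons, Matrix.empty_add_empty]
  iterate 16 refine Matrix.vecCons_inj.2 ⟨by ring, ?_⟩
  rfl

theorem oddAction_smul (v : QSpace) (a : ℂ) (x : Fin 16 → ℂ) :
    oddAction v (a • x) = a • oddAction v x := by
  simp only [oddAction, Pi.smul_apply, smul_eq_mul, Matrix.smul_cons, Matrix.smul_empty, mul_add,
    mul_sub, mul_left_comm a]

theorem oddAction_eq_sum (v : QSpace) (x : Fin 16 → ℂ) :
    oddAction v x = ∑ k, x k • oddAction v (Pi.single k 1) :=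
  eq_sum_smul_single _ (oddAction_add v) (oddAction_smul v) x

theorem cliffordAction_evenSpinor (v : QSpace) (x : Fin 16 → ℂ) :
    cliffordAction v (evenSpinor x) = oddSpinor (evenAction v x) := by
  -- Both sides are linear in the spinor, so the sixteen basis spinors suffice. On these, the
  -- contraction and sorting rules reduce everything to increasing products.
  have h : ∀ k : Fin 16, cliffordAction v (wedgeBasis (evenIndex k)) =
      oddSpinor (evenAction v (Pi.single k 1)) := by
    intro k
    fin_cases k <;>
    simp [evenIndex, wedgeBasis, oddSpinor, oddIndex, evenAction, Fin.sum_univ_succ,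
      cliffordAction_apply, ← gen.eq_1, contr_gen_mul, contr_gen, contr_one, gen_mul_self,
      gen_mul_self_mul, gen_mul_gen, gen_mul_gen_mul] <;> abel
  rw [evenSpinor, map_sum]
  simp only [map_smul, h, oddSpinor]
  rw [evenAction_eq_sum v x]
  simp only [Finset.sum_apply, Pi.smul_apply, smul_eq_mul, Finset.sum_smul, Finset.smul_sum,
      smul_smul]
  exact Finset.sum_comm

theorem cliffordAction_oddSpinor (v : QSpace) (y : Fin 16 → ℂ) :
    cliffordAction v (oddSpinor y) = evenSpinor (oddAction v y) := by
  have h : ∀ k : Fin 16, cliffordAction v (wedgeBasis (oddIndex k)) =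
      evenSpinor (oddAction v (Pi.single k 1)) := by
    intro k
    fin_cases k <;>
    simp [evenIndex, wedgeBasis, evenSpinor, oddIndex, oddAction, Fin.sum_univ_succ,
      cliffordAction_apply, ← gen.eq_1, contr_gen_mul, contr_gen, gen_mul_self,
      gen_mul_self_mul, gen_mul_gen, gen_mul_gen_mul] <;> abel
  rw [oddSpinor, map_sum]
  simp only [map_smul, h, evenSpinor]
  rw [oddAction_eq_sum v y]
  simp only [Finset.sum_apply, Pi.smul_apply, smul_eq_mul, Finset.sum_smul, Finset.smul_sum,
      smul_smul]
  exact Finset.sum_comm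

/-! ### Linear independence of the wedge products -/

theorem algebraMapInv_evenSpinor (x : Fin 16 → ℂ) :
    ExteriorAlgebra.algebraMapInv (evenSpinor x) = x 0 := by
  simp [evenSpinor, Fin.sum_univ_succ, evenIndex, wedgeBasis, ExteriorAlgebra.algebraMapInv]

/-- The projection to scalars detects the coefficient of the empty product. Two or four contractions
move any other coefficient, up to sign, to that place. -/
theorem eq_zero_of_evenSpinor_eq_zero {x : Fin 16 → ℂ} (hx : evenSpinor x = 0) : x = 0 := by
  have h0 : ∀ x, evenSpinor x = 0 → x 0 = 0 := fun x hx => by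
    rw [← algebraMapInv_evenSpinor x, hx, map_zero]
  have h2 : ∀ x, evenSpinor x = 0 → ∀ u v, evenSpinor (oddAction u (evenAction v x)) = 0 :=
    fun x hx u v => by
      rw [← cliffordAction_oddSpinor, ← cliffordAction_evenSpinor, hx, map_zero, map_zero]
  have hs : ∀ x, evenSpinor x = 0 → ∀ i j : Fin 10,
      oddAction (Pi.single i 1) (evenAction (Pi.single j 1) x) 0 = 0 :=
    fun x hx i j => h0 _ (h2 x hx _ _)
  have h4 : ∀ i j k l : Fin 10, oddAction (Pi.single i 1) (evenAction (Pi.single j 1)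
      (oddAction (Pi.single k 1) (evenAction (Pi.single l 1) x))) 0 = 0 :=
    fun i j k l => hs _ (h2 x hx _ _) i j
  ext k
  fin_cases k
  · exact h0 x hx
  · simpa [oddAction, evenAction] using hs x hx 0 1
  · simpa [oddAction, evenAction] using hs x hx 0 2
  · simpa [oddAction, evenAction] using hs x hx 0 3
  · simpa [oddAction, evenAction] using hs x hx 0 4
  · simpa [oddAction, evenAction] using hs x hx 1 2
  · simpa [oddAction, evenAction] using hs x hx 1 3
  · simpa [oddAction, evenAction] using hs x hx 1 4
  · simpa [oddAction, evenAction] using hs x hx 2 3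
  · simpa [oddAction, evenAction] using hs x hx 2 4
  · simpa [oddAction, evenAction] using hs x hx 3 4
  · simpa [oddAction, evenAction] using h4 0 1 2 3
  · simpa [oddAction, evenAction] using h4 0 1 2 4
  · simpa [oddAction, evenAction] using h4 0 1 3 4
  · simpa [oddAction, evenAction] using h4 0 2 3 4
  · simpa [oddAction, evenAction] using h4 1 2 3 4

theorem eq_zero_of_oddSpinor_eq_zero {y : Fin 16 → ℂ} (hy : oddSpinor y = 0) : y = 0 := by
  have h : ∀ (i : Fin 10) (k : Fin 16), oddAction (Pi.single i 1) y k = 0 := fun i k => by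
    have := cliffordAction_oddSpinor (Pi.single i 1) y
    rw [hy, map_zero] at this
    exact congrFun (eq_zero_of_evenSpinor_eq_zero this.symm) k
  ext k
  fin_cases k
  · simpa [oddAction] using h 0 0
  · simpa [oddAction] using h 1 0
  · simpa [oddAction] using h 2 0
  · simpa [oddAction] using h 3 0
  · simpa [oddAction] using h 4 0
  · simpa [oddAction] using h 2 1
  · simpa [oddAction] using h 3 1
  · simpa [oddAction] using h 4 1
  · simpa [oddAction] using h 3 2
  · simpa [oddAction] using h 4 2
  · simpa [oddAction] using h 4 3
  · simpa [oddAction] using h 3 5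
  · simpa [oddAction] using h 4 5
  · simpa [oddAction] using h 4 6
  · simpa [oddAction] using h 4 8
  · simpa [oddAction] using h 4 11

theorem cliffordAction_evenSpinor_eq_zero_iff (v : QSpace) (x : Fin 16 → ℂ) :
    cliffordAction v (evenSpinor x) = 0 ↔ evenAction v x = 0 := by
  rw [cliffordAction_evenSpinor]
  refine ⟨eq_zero_of_oddSpinor_eq_zero, fun h => by simp [h, oddSpinor]⟩

/-! ### Uniqueness of half spinors -/

/-- The polar form of `quadForm`. -/
def polarForm : LinearMap.BilinForm ℂ QSpace :=
  LinearMap.mk₂ ℂ (fun u w => u 0 * w 5 + u 1 * w 6 + u 2 * w 7 + u 3 * w 8 + u 4 * w 9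
      + u 5 * w 0 + u 6 * w 1 + u 7 * w 2 + u 8 * w 3 + u 9 * w 4)
    (fun _ _ _ => by simp only [Pi.add_apply]; ring)
    (fun _ _ _ => by simp only [Pi.smul_apply, smul_eq_mul]; ring)
    (fun _ _ _ => by simp only [Pi.add_apply]; ring)
    (fun _ _ _ => by simp only [Pi.smul_apply, smul_eq_mul]; ring)

theorem polarForm_apply (u w : QSpace) : polarForm u w =
    u 0 * w 5 + u 1 * w 6 + u 2 * w 7 + u 3 * w 8 + u 4 * w 9
      + u 5 * w 0 + u 6 * w 1 + u 7 * w 2 + u 8 * w 3 + u 9 * w 4 := rfl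

theorem polarForm_comm (u w : QSpace) : polarForm u w = polarForm w u := by
  simp only [polarForm_apply]; ring

theorem quadForm_apply (v : QSpace) :
    quadForm v = v 0 * v 5 + v 1 * v 6 + v 2 * v 7 + v 3 * v 8 + v 4 * v 9 := by
  rw [quadForm, Fin.sum_univ_five]; rfl

theorem polarForm_self (v : QSpace) : polarForm v v = 2 * quadForm v := by
  rw [quadForm_apply, polarForm_apply]; ring

theorem quadForm_add (u w : QSpace) : quadForm (u + w) = quadForm u + quadForm w + polarForm u w :=
    by
  simp only [quadForm_apply, polarForm_apply, Pi.add_apply]; ring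

theorem exists_polarForm_eq (f : QSpace →ₗ[ℂ] ℂ) : ∃ w, ∀ u, polarForm u w = f u := by
  -- Addition in `Fin 10` is modulo 10, so `j + 5` exchanges the two halves of the coordinates, just
  -- as the polar form pairs them.
  refine ⟨fun j => f (Pi.single (j + 5) 1), fun u => ?_⟩
  rw [eq_sum_smul_single f f.map_add f.map_smul u]
  simp [Fin.sum_univ_succ, polarForm_apply]
  ring

theorem polarForm_nondegenerate : polarForm.Nondegenerate := by
  refine ⟨fun u hu => ?_, fun u hu => ?_⟩
  all_goals
    ext j
    obtain ⟨w, hw⟩ := exists_polarForm_eq (LinearMap.proj j)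
    have h := hw u
    simp only [LinearMap.proj_apply] at h
  · rw [← h, hu w]; rfl
  · rw [← h, polarForm_comm, hu w]; rfl

/-- The Clifford relation: contractions anticommute with each other, so do left multiplications by
vectors, and the mixed terms leave the two evaluations d(m') + d'(m). -/
theorem cliffordAction_anticomm (u w : QSpace) (z : ExteriorAlgebra ℂ UInf) :
    cliffordAction u (cliffordAction w z) + cliffordAction w (cliffordAction u z) =
      polarForm u w • z := by
  have key : ∀ (d d' : Module.Dual ℂ UInf) (m m' : UInf),
      (CliffordAlgebra.contractLeft (Q := (0 : QuadraticForm ℂ UInf)) d +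
        LinearMap.mulLeft ℂ (ExteriorAlgebra.ι ℂ m))
        ((CliffordAlgebra.contractLeft (Q := (0 : QuadraticForm ℂ UInf)) d' +
        LinearMap.mulLeft ℂ (ExteriorAlgebra.ι ℂ m')) z) +
      (CliffordAlgebra.contractLeft (Q := (0 : QuadraticForm ℂ UInf)) d' +
        LinearMap.mulLeft ℂ (ExteriorAlgebra.ι ℂ m'))
        ((CliffordAlgebra.contractLeft (Q := (0 : QuadraticForm ℂ UInf)) d +
        LinearMap.mulLeft ℂ (ExteriorAlgebra.ι ℂ m)) z) = (d m' + d' m) • z := by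
    intro d d' m m'
    have h1 := CliffordAlgebra.contractLeft_comm (Q := (0 : QuadraticForm ℂ UInf)) (d := d)
      (d' := d') z
    have h2 := CliffordAlgebra.contractLeft_ι_mul (Q := (0 : QuadraticForm ℂ UInf)) (d := d) m' z
    have h3 := CliffordAlgebra.contractLeft_ι_mul (Q := (0 : QuadraticForm ℂ UInf)) (d := d') m z
    have h4 : ExteriorAlgebra.ι ℂ m * (ExteriorAlgebra.ι ℂ m' * z) =
        - (ExteriorAlgebra.ι ℂ m' * (ExteriorAlgebra.ι ℂ m * z)) := by
      rw [← mul_assoc, ← mul_assoc, ← neg_mul]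
      congr 1
      exact eq_neg_of_add_eq_zero_left (CliffordAlgebra.ι_mul_ι_add_swap_of_isOrtho
        (by simp [QuadraticMap.IsOrtho]))
    simp only [LinearMap.add_apply, LinearMap.mulLeft_apply, map_add]
    erw [h1, h2, h3, h4]
    module
  have hd : ∀ (v : QSpace) (m : UInf), (∑ i : Fin 5, v (Fin.castAdd 5 i) •
      (LinearMap.proj i : UInf →ₗ[ℂ] ℂ) : UInf →ₗ[ℂ] ℂ) m =
        v 0 * m 0 + v 1 * m 1 + v 2 * m 2 + v 3 * m 3 + v 4 * m 4 := fun v m => by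
    rw [Fin.sum_univ_five]; rfl
  refine (key _ _ _ _).trans (congrArg (· • z) ?_)
  refine (congrArg₂ (· + ·) (hd u _) (hd w _)).trans ?_
  change u 0 * w 5 + u 1 * w 6 + u 2 * w 7 + u 3 * w 8 + u 4 * w 9 +
    (w 0 * u 5 + w 1 * u 6 + w 2 * u 7 + w 3 * u 8 + w 4 * u 9) = _
  rw [polarForm_apply]
  ring

theorem finrank_exteriorAlgebra : Module.finrank ℂ (ExteriorAlgebra ℂ UInf) = 32 := by
  rw [Module.finrank_eq_card_basis (Pi.basisFun ℂ (Fin 5)).ExteriorAlgebra]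
  simp

instance : FiniteDimensional ℂ (ExteriorAlgebra ℂ UInf) :=
  Module.Finite.of_basis (Pi.basisFun ℂ (Fin 5)).ExteriorAlgebra

/-- An operator of square zero that has a contracting homotopy halves the dimension. -/
theorem finrank_eq_two_mul_finrank_inf_ker {S : Type*} [AddCommGroup S] [Module ℂ S]
    [FiniteDimensional ℂ S] (K : Submodule ℂ S) (A W : S →ₗ[ℂ] S) (hA : ∀ z ∈ K, A z ∈ K)
    (hW : ∀ z ∈ K, W z ∈ K) (hAA : ∀ z ∈ K, A (A z) = 0) (hAW : ∀ z ∈ K, A (W z) + W (A z) = z) :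
    Module.finrank ℂ K = 2 * Module.finrank ℂ (K ⊓ LinearMap.ker A : Submodule ℂ S) := by
  have h1 : (LinearMap.ker (A.restrict hA)).map K.subtype = K ⊓ LinearMap.ker A := by
    ext z
    simp only [Submodule.mem_map, LinearMap.mem_ker, Submodule.mem_inf]
    constructor
    · rintro ⟨y, hy, rfl⟩
      exact ⟨y.2, by simpa using congrArg Subtype.val hy⟩
    · rintro ⟨hz, hz'⟩
      exact ⟨⟨z, hz⟩, Subtype.ext hz', rfl⟩
  -- `A` is exact on `K`: if A z = 0, the homotopy relation gives z = A (W z). Rank-nullity then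
  -- makes the kernel half of `K`.
  have h2 : LinearMap.range (A.restrict hA) = LinearMap.ker (A.restrict hA) := by
    ext z
    simp only [LinearMap.mem_range, LinearMap.mem_ker]
    constructor
    · rintro ⟨y, rfl⟩
      exact Subtype.ext (hAA y y.2)
    · intro hz
      refine ⟨⟨W z, hW z z.2⟩, Subtype.ext ?_⟩
      have hz' : A z = 0 := congrArg Subtype.val hz
      have := hAW z z.2
      rw [hz', map_zero, add_zero] at this
      exact this
  have h3 := LinearMap.finrank_range_add_finrank_ker (A.restrict hA)
  rw [h2] at h3
  rw [← h1, Submodule.finrank_map_subtype_eq, ← h3, two_mul]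

/-- The spinors that are annihilated by all members of a family of vectors. -/
def annihilatedSpinors {n : ℕ} (u : Fin n → QSpace) : Submodule ℂ (ExteriorAlgebra ℂ UInf) :=
  ⨅ i, LinearMap.ker (cliffordAction (u i))

theorem mem_annihilatedSpinors {n : ℕ} {u : Fin n → QSpace} {z : ExteriorAlgebra ℂ UInf} :
    z ∈ annihilatedSpinors u ↔ ∀ i, cliffordAction (u i) z = 0 := by
  simp [annihilatedSpinors, Submodule.mem_iInf]

/-- Induction on the number of vectors, starting from dim Λ U_∞ = 32. The last vector acts with
square zero on the spinors annihilated by the others. A vector `w` pairing to 1 with it and to 0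
with the others acts as a contracting homotopy, so the dimension halves. -/
theorem two_pow_mul_finrank_annihilatedSpinors {n : ℕ} (u : Fin n → QSpace)
    (hu : LinearIndependent ℂ u) (hiso : ∀ i j, polarForm (u i) (u j) = 0) :
    2 ^ n * Module.finrank ℂ (annihilatedSpinors u) = 32 := by
  induction n with
  | zero =>
    have : annihilatedSpinors u = ⊤ := by
      ext z; simp [mem_annihilatedSpinors]
    rw [this, finrank_top, finrank_exteriorAlgebra]; norm_num
  | succ n ih =>
    obtain ⟨h1, h2⟩ := linearIndependent_finSucc'.1 hu
    have ih' := ih (Fin.init u) h1 fun i j => hiso _ _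
    -- By independence some functional kills the earlier vectors but not the last; normalized, it is
    -- represented by `w` through the polar form.
    obtain ⟨f, hf, hf'⟩ := Submodule.exists_le_ker_of_notMem h2
    obtain ⟨w, hw⟩ := exists_polarForm_eq ((f (u (Fin.last n)))⁻¹ • f)
    have hw1 : polarForm (u (Fin.last n)) w = 1 := by
      rw [hw, LinearMap.smul_apply, smul_eq_mul, inv_mul_cancel₀ hf]
    have hw0 : ∀ i : Fin n, polarForm (u i.castSucc) w = 0 := fun i => by
      have : f (u i.castSucc) = 0 := hf' (Submodule.subset_span ⟨i, rfl⟩)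
      rw [hw, LinearMap.smul_apply, this, smul_zero]
    have hpres : ∀ v, (∀ i : Fin n, polarForm (u i.castSucc) v = 0) →
        ∀ z ∈ annihilatedSpinors (Fin.init u),
          cliffordAction v z ∈ annihilatedSpinors (Fin.init u) := by
      intro v hv z hz
      rw [mem_annihilatedSpinors] at hz ⊢
      intro i
      have h := cliffordAction_anticomm (Fin.init u i) v z
      rw [hz i, map_zero, add_zero] at h
      rw [h]
      exact (congrArg (· • z) (hv i)).trans (zero_smul _ _)
    have h3 := finrank_eq_two_mul_finrank_inf_ker (annihilatedSpinors (Fin.init u))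
      (cliffordAction (u (Fin.last n))) (cliffordAction w) (hpres _ fun i => hiso _ _)
      (hpres _ hw0)
      (fun z _ => by
        have h := cliffordAction_anticomm (u (Fin.last n)) (u (Fin.last n)) z
        rw [hiso, zero_smul, ← two_smul ℂ] at h
        exact (smul_eq_zero.1 h).resolve_left two_ne_zero)
      (fun z _ => by rw [cliffordAction_anticomm, hw1, one_smul])
    have h4 : annihilatedSpinors (Fin.init u) ⊓ LinearMap.ker (cliffordAction (u (Fin.last n))) =
        annihilatedSpinors u := by
      ext z
      simp only [Submodule.mem_inf, mem_annihilatedSpinors, LinearMap.mem_ker, Fin.forall_fin_succ',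
        Fin.init]
    rw [h3, h4] at ih'
    rw [← ih']; ring

theorem evenSpinor_smul (a : ℂ) (x : Fin 16 → ℂ) : evenSpinor (a • x) = a • evenSpinor x := by
  simp [evenSpinor, Finset.smul_sum, smul_smul]

theorem evenSpinor_sub (x y : Fin 16 → ℂ) :
    evenSpinor (x - y) = evenSpinor x - evenSpinor y := by
  simp [evenSpinor, sub_smul]

theorem IsLagrangian.polarForm_eq_zero {U : Submodule ℂ QSpace} (hU : IsLagrangian U) {u w : QSpace}
    (hu : u ∈ U) (hw : w ∈ U) : polarForm u w = 0 := by
  have h := quadForm_add u w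
  rw [hU.2 u hu, hU.2 w hw, hU.2 _ (U.add_mem hu hw)] at h
  simpa using h.symm

/-- A Lagrangian has at most one half spinor. -/
theorem IsLagrangian.exists_smul_eq {U : Submodule ℂ QSpace} (hU : IsLagrangian U)
    {x y : Fin 16 → ℂ} (hx : ∀ u ∈ U, cliffordAction u (evenSpinor x) = 0)
    (hy : ∀ u ∈ U, cliffordAction u (evenSpinor y) = 0) (hy0 : y ≠ 0) : ∃ a : ℂ, a • y = x := by
  let b := Module.finBasisOfFinrankEq ℂ U hU.1
  have h := two_pow_mul_finrank_annihilatedSpinors (fun i => (b i : QSpace))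
    (b.linearIndependent.map' U.subtype U.ker_subtype)
    (fun i j => hU.polarForm_eq_zero (b i).2 (b j).2)
  -- 2⁵ · dim = 32, so the annihilated spinors, of either parity, form a line.
  have h1 : Module.finrank ℂ (annihilatedSpinors fun i => (b i : QSpace)) = 1 := by omega
  have hy' : evenSpinor y ≠ 0 := fun h => hy0 (eq_zero_of_evenSpinor_eq_zero h)
  obtain ⟨a, ha⟩ := exists_smul_eq_of_finrank_eq_one h1
    (x := ⟨evenSpinor y, mem_annihilatedSpinors.2 fun i => hy _ (b i).2⟩)
    (fun h => hy' (congrArg Subtype.val h))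
    ⟨evenSpinor x, mem_annihilatedSpinors.2 fun i => hx _ (b i).2⟩
  refine ⟨a, sub_eq_zero.1 (eq_zero_of_evenSpinor_eq_zero ?_)⟩
  rw [evenSpinor_sub, evenSpinor_smul, sub_eq_zero]
  exact congrArg Subtype.val ha

/-! ### Equations of the orthogonal Grassmannian -/

/-- The invariant pairing of even and odd spinors. -/
def spinorPairing (x y : Fin 16 → ℂ) : ℂ :=
  x 0 * y 15 - x 1 * y 14 + x 2 * y 13 - x 3 * y 12 + x 4 * y 11 - x 5 * y 10 + x 6 * y 9
    - x 7 * y 8 - x 8 * y 7 + x 9 * y 6 - x 10 * y 5 + x 11 * y 4 - x 12 * y 3 + x 13 * y 2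
    - x 14 * y 1 + x 15 * y 0

/-- The symmetric equivariant map from pairs of even spinors to vectors. -/
def vectorForm (x y : Fin 16 → ℂ) : QSpace :=
  ![x 15 * y 0 - x 10 * y 5 + x 9 * y 6 - x 8 * y 7 - x 7 * y 8 + x 6 * y 9 - x 5 * y 10 + x 0 * y
      15,
    -x 14 * y 0 + x 10 * y 2 - x 9 * y 3 + x 8 * y 4 + x 4 * y 8 - x 3 * y 9 + x 2 * y 10 - x 0 * y
        14,
    x 13 * y 0 - x 10 * y 1 + x 7 * y 3 - x 6 * y 4 - x 4 * y 6 + x 3 * y 7 - x 1 * y 10 + x 0 * y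
        13,
    -x 12 * y 0 + x 9 * y 1 - x 7 * y 2 + x 5 * y 4 + x 4 * y 5 - x 2 * y 7 + x 1 * y 9 - x 0 * y
        12,
    x 11 * y 0 - x 8 * y 1 + x 6 * y 2 - x 5 * y 3 - x 3 * y 5 + x 2 * y 6 - x 1 * y 8 + x 0 * y 11,
    -x 14 * y 1 + x 13 * y 2 - x 12 * y 3 + x 11 * y 4 + x 4 * y 11 - x 3 * y 12 + x 2 * y 13
      - x 1 * y 14,
    -x 15 * y 1 + x 13 * y 5 - x 12 * y 6 + x 11 * y 7 + x 7 * y 11 - x 6 * y 12 + x 5 * y 13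
      - x 1 * y 15,
    -x 15 * y 2 + x 14 * y 5 - x 12 * y 8 + x 11 * y 9 + x 9 * y 11 - x 8 * y 12 + x 5 * y 14
      - x 2 * y 15,
    -x 15 * y 3 + x 14 * y 6 - x 13 * y 8 + x 11 * y 10 + x 10 * y 11 - x 8 * y 13 + x 6 * y 14
      - x 3 * y 15,
    -x 15 * y 4 + x 14 * y 7 - x 13 * y 9 + x 12 * y 10 + x 10 * y 12 - x 9 * y 13 + x 7 * y 14
      - x 4 * y 15]

theorem vectorForm_comm (x y : Fin 16 → ℂ) : vectorForm x y = vectorForm y x := by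
  simp only [vectorForm]
  iterate 10 refine Matrix.vecCons_inj.2 ⟨by ring, ?_⟩
  rfl

theorem vectorForm_add (x y z : Fin 16 → ℂ) :
    vectorForm x (y + z) = vectorForm x y + vectorForm x z := by
  simp only [vectorForm, Pi.add_apply, Matrix.cons_add_cons, Matrix.empty_add_empty]
  iterate 10 refine Matrix.vecCons_inj.2 ⟨by ring, ?_⟩
  rfl

theorem vectorForm_smul (a : ℂ) (x y : Fin 16 → ℂ) :
    vectorForm x (a • y) = a • vectorForm x y := by
  simp only [vectorForm, Pi.smul_apply, smul_eq_mul, Matrix.smul_cons, Matrix.smul_empty]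
  iterate 10 refine Matrix.vecCons_inj.2 ⟨by ring, ?_⟩
  rfl

theorem evenAction_add_left (u v : QSpace) (x : Fin 16 → ℂ) :
    evenAction (u + v) x = evenAction u x + evenAction v x := by
  simp only [evenAction, Pi.add_apply, Matrix.cons_add_cons, Matrix.empty_add_empty]
  iterate 16 refine Matrix.vecCons_inj.2 ⟨by ring, ?_⟩
  rfl

theorem evenAction_smul_left (a : ℂ) (v : QSpace) (x : Fin 16 → ℂ) :
    evenAction (a • v) x = a • evenAction v x := by
  simp only [evenAction, Pi.smul_apply, smul_eq_mul, Matrix.smul_cons, Matrix.smul_empty]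
  iterate 16 refine Matrix.vecCons_inj.2 ⟨by ring, ?_⟩
  rfl

theorem oddAction_zero (v : QSpace) : oddAction v 0 = 0 := by
  simpa using oddAction_smul v 0 0

theorem eq_vec_sixteen {a : Fin 16 → ℂ} : a = ![a 0, a 1, a 2, a 3, a 4, a 5, a 6, a 7, a 8, a 9,
    a 10, a 11, a 12, a 13, a 14, a 15] := by
  ext j; fin_cases j <;> rfl

theorem oddAction_evenAction (u w : QSpace) (x : Fin 16 → ℂ) :
    oddAction u (evenAction w x) + oddAction w (evenAction u x) = polarForm u w • x := by
  refine Eq.trans ?_ eq_vec_sixteen.symm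
  simp only [oddAction, evenAction, Matrix.cons_add_cons, Matrix.empty_add_empty, polarForm_apply,
    Pi.smul_apply, smul_eq_mul, Matrix.cons_val]
  iterate 16 refine Matrix.vecCons_inj.2 ⟨by ring, ?_⟩
  rfl

/-- This characterizes `vectorForm` as the adjoint of the Clifford action with respect to the two
pairings. -/
theorem spinorPairing_evenAction (x y : Fin 16 → ℂ) (v : QSpace) :
    spinorPairing x (evenAction v y) = polarForm (vectorForm x y) v := by
  simp only [spinorPairing, evenAction, polarForm_apply, vectorForm, Matrix.cons_val]
  ring

theorem spinorPairing_oddAction_comm (u : QSpace) (y z : Fin 16 → ℂ) :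
    spinorPairing (oddAction u y) z = spinorPairing (oddAction u z) y := by
  simp only [spinorPairing, oddAction, Matrix.cons_val]
  ring

/-- The polarization of the cubic identity φ_{q(x)} x = 0. When q(x) = 0 it shows that every β(x, y)
annihilates x. -/
theorem evenAction_vectorForm (x y : Fin 16 → ℂ) :
    evenAction (vectorForm x x) y + (2 : ℂ) • evenAction (vectorForm x y) x = 0 := by
  refine Eq.trans ?_ eq_vec_sixteen.symm
  simp only [evenAction, vectorForm, Matrix.cons_add_cons, Matrix.empty_add_empty,
    Matrix.smul_cons, Matrix.smul_empty, smul_eq_mul, Matrix.cons_val, Pi.zero_apply]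
  iterate 16 refine Matrix.vecCons_inj.2 ⟨by ring, ?_⟩
  rfl

theorem eq_zero_of_spinorPairing_eq_zero {z : Fin 16 → ℂ} (h : ∀ y, spinorPairing y z = 0) :
    z = 0 := by
  ext k
  -- The pairing matches coordinate k with coordinate 15 - k, up to sign.
  have := h (Pi.single k.rev 1)
  fin_cases k <;> simpa [spinorPairing, Fin.rev] using this

/-- The vectors that annihilate an even spinor. -/
def annihilator (x : Fin 16 → ℂ) : Submodule ℂ QSpace where
  carrier := {v | evenAction v x = 0}
  zero_mem' := by simpa using evenAction_smul_left 0 0 x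
  add_mem' := fun {u v} (hu : _ = _) (hv : _ = _) => by
    simp [evenAction_add_left, hu, hv]
  smul_mem' := fun a v (hv : _ = _) => by
    simp [evenAction_smul_left, hv]

theorem mem_annihilator {v : QSpace} {x : Fin 16 → ℂ} : v ∈ annihilator x ↔ evenAction v x = 0 :=
  Iff.rfl

theorem isHalfSpinor_iff {U : Submodule ℂ QSpace} {x : PSpace 16} :
    IsHalfSpinor U x ↔ U ≤ annihilator x.rep := by
  simp only [IsHalfSpinor, cliffordAction_evenSpinor_eq_zero_iff]
  rfl

/-- Pure spinors satisfy the quadratic equations. -/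
theorem vectorForm_self_eq_zero {U : Submodule ℂ QSpace} (hU : Module.finrank ℂ U = 5)
    {x : Fin 16 → ℂ} (hx : U ≤ annihilator x) : vectorForm x x = 0 := by
  refine polarForm_nondegenerate.1 _ fun v => ?_
  -- Choose u ≠ 0 in U orthogonal to v, and w with B(u, w) = 1. The Clifford relation gives x = φ_u
  -- φ_w x and φ_u φ_v x = 0. Then B(q(x), v) = ⟨x, φ_v x⟩ = ⟨φ_u φ_w x, φ_v x⟩ = ⟨φ_u φ_v x, φ_w x⟩
  -- = 0.
  have hker : LinearMap.ker ((polarForm.flip v).comp U.subtype) ≠ ⊥ :=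
    LinearMap.ker_ne_bot_of_finrank_lt (by rw [hU, Module.finrank_self]; norm_num)
  obtain ⟨⟨u, hu⟩, huv, hu0⟩ := Submodule.exists_mem_ne_zero_of_ne_bot hker
  have huv : polarForm u v = 0 := huv
  have hu0 : u ≠ 0 := fun h => hu0 (Subtype.ext h)
  obtain ⟨w', hw'⟩ : ∃ w, polarForm u w ≠ 0 := by
    by_contra! h
    exact hu0 (polarForm_nondegenerate.1 u h)
  have hw : polarForm u ((polarForm u w')⁻¹ • w') = 1 := by
    rw [map_smul, smul_eq_mul, inv_mul_cancel₀ hw']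
  set w := (polarForm u w')⁻¹ • w'
  have hux : evenAction u x = 0 := hx hu
  have h1 : oddAction u (evenAction w x) = x := by
    have := oddAction_evenAction u w x
    rwa [hux, oddAction_zero, add_zero, hw, one_smul] at this
  have h2 : oddAction u (evenAction v x) = 0 := by
    have := oddAction_evenAction u v x
    rwa [hux, oddAction_zero, add_zero, huv, zero_smul] at this
  rw [← spinorPairing_evenAction]
  nth_rewrite 1 [← h1]
  rw [spinorPairing_oddAction_comm, h2]
  simp [spinorPairing]

/-- `vectorForm` as a linear map in its second argument. -/
def vectorFormHom (x : Fin 16 → ℂ) : (Fin 16 → ℂ) →ₗ[ℂ] QSpace where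
  toFun := vectorForm x
  map_add' := vectorForm_add x
  map_smul' := fun a y => vectorForm_smul a x y

/-- The spinor pairing is nondegenerate, so φ_v x = 0 exactly when ⟨y, φ_v x⟩ = B(β(x, y), v)
vanishes for all y. -/
theorem annihilator_eq_orthogonal (x : Fin 16 → ℂ) :
    annihilator x = polarForm.orthogonal (LinearMap.range (vectorFormHom x)) := by
  ext v
  rw [LinearMap.BilinForm.mem_orthogonal_iff, mem_annihilator]
  have h : ∀ y, polarForm (vectorForm x y) v = spinorPairing y (evenAction v x) := fun y => by
    rw [vectorForm_comm, spinorPairing_evenAction]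
  constructor
  · rintro hv _ ⟨y, rfl⟩
    refine (h y).trans ?_
    rw [hv]; simp [spinorPairing]
  · intro hv
    exact eq_zero_of_spinorPairing_eq_zero fun y => by rw [← h]; exact hv _ ⟨y, rfl⟩

theorem vectorForm_mem_annihilator {x : Fin 16 → ℂ} (hx : vectorForm x x = 0) (y : Fin 16 → ℂ) :
    vectorForm x y ∈ annihilator x := by
  have h := evenAction_vectorForm x y
  rw [hx, show evenAction 0 y = 0 by simpa using evenAction_smul_left 0 0 y, zero_add] at h
  exact (smul_eq_zero.1 h).resolve_left two_ne_zero

theorem quadForm_eq_zero_of_mem_annihilator {x : Fin 16 → ℂ} (hx0 : x ≠ 0) {v : QSpace}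
    (hv : v ∈ annihilator x) : quadForm v = 0 := by
  have h := oddAction_evenAction v v x
  rw [mem_annihilator.1 hv, oddAction_zero, add_zero, polarForm_self] at h
  simpa [hx0] using h.symm

/-- The solutions of the quadratic equations are pure spinors. -/
theorem isLagrangian_annihilator {x : Fin 16 → ℂ} (hx0 : x ≠ 0) (hx : vectorForm x x = 0) :
    IsLagrangian (annihilator x) := by
  refine ⟨?_, fun u hu => quadForm_eq_zero_of_mem_annihilator hx0 hu⟩
  have h1 : LinearMap.range (vectorFormHom x) ≤ annihilator x := by
    rintro _ ⟨y, rfl⟩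
    exact vectorForm_mem_annihilator hx y
  have h2 : annihilator x ≤ polarForm.orthogonal (annihilator x) := by
    intro v hv
    rw [LinearMap.BilinForm.mem_orthogonal_iff]
    intro u hu
    have h := quadForm_add u v
    rw [quadForm_eq_zero_of_mem_annihilator hx0 hu, quadForm_eq_zero_of_mem_annihilator hx0 hv,
      quadForm_eq_zero_of_mem_annihilator hx0 (Submodule.add_mem _ hu hv)] at h
    simpa using h.symm
  have h3 := Submodule.finrank_mono h1
  have h4 := Submodule.finrank_mono h2
  have h5 := LinearMap.BilinForm.finrank_orthogonal polarForm_nondegenerate (annihilator x)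
  have h6 := LinearMap.BilinForm.finrank_orthogonal polarForm_nondegenerate
    (LinearMap.range (vectorFormHom x))
  rw [← annihilator_eq_orthogonal] at h6
  have h7 : Module.finrank ℂ QSpace = 10 := by simp
  -- Let r be the rank of β(x, ·) and a the dimension of the annihilator. Then r ≤ a, a ≤ 10 - a and
  -- a = 10 - r, which forces a = 5.
  omega

theorem vectorForm_smul_smul (a : ℂ) (x : Fin 16 → ℂ) :
    vectorForm (a • x) (a • x) = a ^ 2 • vectorForm x x := by
  rw [vectorForm_smul, vectorForm_comm, vectorForm_smul, smul_smul, sq]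

theorem mk_mem_OG_iff {x : Fin 16 → ℂ} (hx : x ≠ 0) :
    Projectivization.mk ℂ x hx ∈ OG ↔ vectorForm x x = 0 := by
  obtain ⟨a, ha⟩ := Projectivization.exists_smul_eq_mk_rep ℂ x hx
  have h : vectorForm x x = 0 ↔
      vectorForm (Projectivization.mk ℂ x hx).rep (Projectivization.mk ℂ x hx).rep = 0 := by
    rw [← ha, Units.smul_def, vectorForm_smul_smul]
    simp
  rw [h]
  constructor
  · rintro ⟨U, hU, hUx⟩
    exact vectorForm_self_eq_zero hU.1 (isHalfSpinor_iff.1 hUx)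
  · intro hx
    exact ⟨_, isLagrangian_annihilator (Projectivization.rep_nonzero _) hx,
      isHalfSpinor_iff.2 le_rfl⟩

/-! ### The linear map inducing the spinor map -/

/-- The linear map whose projectivization is the spinor map of the curve. -/
def spinorLift (t₀ t₁ : ℂ) : (Fin 7 → ℂ) →ₗ[ℂ] (Fin 16 → ℂ) where
  toFun y := ![-(t₁ * (t₀ - t₁) * y 3), t₁ * y 2, t₁ * y 2, 0, -((t₀ - t₁) * y 3), -(t₁ * y 4),
    -(t₁ * y 1), -(t₁ * y 4), -(t₁ * (y 0 + y 3 - y 4)), -(t₀ * y 3), t₁ * (y 3 - y 4), 0, -y 5, 0,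
    y 6, 0]
  map_add' x y := by
    simp only [Pi.add_apply, Matrix.cons_add_cons, Matrix.empty_add_empty]
    iterate 16 refine Matrix.vecCons_inj.2 ⟨by ring, ?_⟩
    rfl
  map_smul' a y := by
    simp only [Pi.smul_apply, smul_eq_mul, Matrix.smul_cons, Matrix.smul_empty, RingHom.id_apply]
    iterate 16 refine Matrix.vecCons_inj.2 ⟨by ring, ?_⟩
    rfl

theorem spinorLift_apply (t₀ t₁ : ℂ) (y : Fin 7 → ℂ) : spinorLift t₀ t₁ y =
    ![-(t₁ * (t₀ - t₁) * y 3), t₁ * y 2, t₁ * y 2, 0, -((t₀ - t₁) * y 3), -(t₁ * y 4),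
    -(t₁ * y 1), -(t₁ * y 4), -(t₁ * (y 0 + y 3 - y 4)), -(t₀ * y 3), t₁ * (y 3 - y 4), 0, -y 5, 0,
    y 6, 0] := rfl

/-- A left inverse of `spinorLift`. -/
def spinorProj (t₀ t₁ : ℂ) : (Fin 16 → ℂ) →ₗ[ℂ] (Fin 7 → ℂ) where
  toFun x := ![-(t₁⁻¹ * x 8) + (t₀ - t₁)⁻¹ * x 4 - t₁⁻¹ * x 5, -(t₁⁻¹ * x 6), t₁⁻¹ * x 1,
    -((t₀ - t₁)⁻¹ * x 4), -(t₁⁻¹ * x 5), -x 12, x 14]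
  map_add' x y := by
    simp only [Pi.add_apply, Matrix.cons_add_cons, Matrix.empty_add_empty]
    iterate 7 refine Matrix.vecCons_inj.2 ⟨by ring, ?_⟩
    rfl
  map_smul' a y := by
    simp only [Pi.smul_apply, smul_eq_mul, Matrix.smul_cons, Matrix.smul_empty, RingHom.id_apply]
    iterate 7 refine Matrix.vecCons_inj.2 ⟨by ring, ?_⟩
    rfl

theorem spinorProj_spinorLift {t₀ t₁ : ℂ} (h_one : t₀ ≠ t₁) (h_infty : t₁ ≠ 0) (y : Fin 7 → ℂ) :
    spinorProj t₀ t₁ (spinorLift t₀ t₁ y) = y := by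
  have hs : t₀ - t₁ ≠ 0 := sub_ne_zero.2 h_one
  ext j
  fin_cases j <;> simp [spinorLift, spinorProj] <;> field_simp
  ring

theorem spinorLift_injective {t₀ t₁ : ℂ} (h_one : t₀ ≠ t₁) (h_infty : t₁ ≠ 0) :
    Function.Injective (spinorLift t₀ t₁) :=
  Function.LeftInverse.injective (spinorProj_spinorLift h_one h_infty)

theorem range_spinorLift {t₀ t₁ : ℂ} (h_infty : t₁ ≠ 0) :
    LinearMap.range (spinorLift t₀ t₁) = Submodule.span ℂ (Set.range (spinorMatrix t₀ t₁).row) := by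
  -- The coefficients can be read off columns 1, 6, 8, 4, 10, 12, 14 of M_t (counted from 0), each
  -- of which meets only one row. Solving them for y gives the preimage used for the reverse
  -- inclusion.
  have key : ∀ y : Fin 7 → ℂ, spinorLift t₀ t₁ y = ∑ i, ![t₁ * y 2, -(t₁ * y 1),
      -(t₁ * (y 0 + y 3 - y 4)), -y 3, t₁ * (y 3 - y 4), -y 5, y 6] i • (spinorMatrix t₀ t₁).row i
          := by
    intro y
    ext j
    simp only [Finset.sum_apply, Pi.smul_apply, smul_eq_mul, Fin.sum_univ_succ, Matrix.row]
    fin_cases j <;> simp [spinorLift, spinorMatrix] <;> ring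
  ext x
  rw [LinearMap.mem_range, Submodule.mem_span_range_iff_exists_fun]
  constructor
  · rintro ⟨y, rfl⟩
    exact ⟨_, (key y).symm⟩
  · rintro ⟨c, rfl⟩
    refine ⟨![-t₁⁻¹ * c 2 - t₁⁻¹ * c 4, -t₁⁻¹ * c 1, t₁⁻¹ * c 0, -c 3, -c 3 - t₁⁻¹ * c 4, -c 5,
      c 6], (key _).trans (Finset.sum_congr rfl fun i _ => congrArg (· • _) ?_)⟩
    fin_cases i <;> simp <;> field_simp
    ring

/-- The values of the quadrics. -/
def quadricValue (t₀ t₁ : ℂ) (y : Fin 7 → ℂ) : QSpace := fun j => eval y (quadric t₀ t₁ j)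

theorem quadricValue_eq (t₀ t₁ : ℂ) (y : Fin 7 → ℂ) : quadricValue t₀ t₁ y =
    ![-t₀ * y 1 * y 3 + t₁ * y 0 * y 4,
    -(t₀ - t₁) * y 0 * y 3 - t₁ * y 2 * y 3 - (t₀ - t₁) * y 3 ^ 2 + t₁ * y 2 * y 4
      + (t₀ - t₁) * y 3 * y 4 - (t₀ - t₁) * y 3 * y 6,
    (t₀ - t₁) * y 1 * y 3 + t₁ * y 2 * y 3 - t₁ * y 2 * y 4,
    t₀ * y 2 * y 3 - t₁ * y 2 * y 4 - (t₀ - t₁) * y 3 * y 4 + (t₀ - t₁) * y 3 * y 5,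
    -t₁ * y 0 * y 2 + t₁ * y 1 * y 2 - t₁ * y 2 * y 3 + t₁ * y 2 * y 4,
    y 2 * y 6,
    y 1 * y 5,
    y 0 * y 5 + y 3 * y 5 - y 4 * y 5 + y 4 * y 6,
    y 1 * y 6,
    y 3 * y 5 - y 4 * y 5 + y 4 * y 6] := by
  ext j
  fin_cases j <;> simp [quadricValue, quadric]

/-- The central identity: restricted to P_t, the equations of the orthogonal Grassmannian are the
quadrics through the curve, up to the nonzero factor. -/
theorem vectorForm_spinorLift (t₀ t₁ : ℂ) (y : Fin 7 → ℂ) :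
    vectorForm (spinorLift t₀ t₁ y) (spinorLift t₀ t₁ y) = (-2 * t₁) • quadricValue t₀ t₁ y := by
  rw [quadricValue_eq, spinorLift_apply]
  simp only [vectorForm, Matrix.cons_val, Matrix.smul_cons, Matrix.smul_empty, smul_eq_mul]
  iterate 10 refine Matrix.vecCons_inj.2 ⟨by ring, ?_⟩
  rfl

/-! ### The curve is cut out by the quadrics -/

theorem quadricValue_eq_zero_of_component {t₀ t₁ : ℂ} {y : Fin 7 → ℂ} (v : Fin 11)
    (h : ∀ f ∈ componentEqs t₀ t₁ v, eval y f = 0) : quadricValue t₀ t₁ y = 0 := by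
  rw [quadricValue_eq]
  fin_cases v <;> simp [componentEqs] at h
  · obtain ⟨h1, h2, h3, h4, h5⟩ := h
    simp [h1, h2, h3, h4, h5]
  · obtain ⟨h1, h2, h3, h4, h5⟩ := h
    simp [h1, h2, h3, h4, h5]
  · obtain ⟨h1, h2, h3, h4, h5⟩ := h
    rw [sub_eq_zero] at h5
    simp [h1, h2, h3, h4, h5]
  · obtain ⟨h1, h2, h3, h4, h5⟩ := h
    have h4 : y 1 = y 2 - y 4 := by linear_combination h4
    have h5 : y 0 = y 2 - y 3 := by linear_combination h5
    simp only [h2, h3, h4, h5]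
    ext j
    fin_cases j <;> simp <;> grind
  · obtain ⟨h1, h2, h3, h4, h5⟩ := h
    ext j
    fin_cases j <;> simp <;> grind
  · obtain ⟨h1, h2, h3, h4, h5⟩ := h
    ext j
    fin_cases j <;> simp <;> grind
  · obtain ⟨h1, h2, h3, h4, h5⟩ := h
    ext j
    fin_cases j <;> simp <;> grind
  · obtain ⟨h1, h2, h3, h4, h5⟩ := h
    simp [h1, h2, h3, h4, h5]
  · obtain ⟨h1, h2, h3, h4, h5⟩ := h
    ext j
    fin_cases j <;> simp <;> grind
  · obtain ⟨h1, h2, h3, h4, h5⟩ := h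
    simp [h1, h2, h3, h4, h5]
  · obtain ⟨h1, h2, h3, h4, h5⟩ := h
    simp [h1, h2, h3, h4, h5]

/-- On the successive coordinate cuts, combinations of the quadrics become products of linear forms,
and choosing factors leads to the components. The cut y₆ = 0 contains 1, 2, 34, 5, 10, 11, and
within it y₅ = 0 contains 1, 2, 34, 10. -/
theorem exists_component_of_quadricValue_eq_zero {t₀ t₁ : ℂ} (h_one : t₀ ≠ t₁) (h_infty : t₁ ≠ 0)
    {y : Fin 7 → ℂ} (h : quadricValue t₀ t₁ y = 0) :
    ∃ v : Fin 11, ∀ f ∈ componentEqs t₀ t₁ v, eval y f = 0 := by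
  have hs : t₀ - t₁ ≠ 0 := sub_ne_zero.2 h_one
  rw [quadricValue_eq] at h
  have e0 := congrFun h 0
  have e1 := congrFun h 1
  have e2 := congrFun h 2
  have e3 := congrFun h 3
  have e4 := congrFun h 4
  have e5 := congrFun h 5
  have e6 := congrFun h 6
  have e7 := congrFun h 7
  have e8 := congrFun h 8
  have e9 := congrFun h 9
  clear h
  simp only [Matrix.cons_val, Pi.zero_apply] at e0 e1 e2 e3 e4 e5 e6 e7 e8 e9
  have f1 : y 0 * y 5 = 0 := by linear_combination e7 - e9
  have f2 : y 2 * (y 1 - y 0 - y 3 + y 4) = 0 :=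
    (mul_eq_zero.1 (show t₁ * (y 2 * (y 1 - y 0 - y 3 + y 4)) = 0 by
      linear_combination e4)).resolve_left h_infty
  have f3 : y 3 * (y 1 - y 0 - y 3 + y 4 - y 6) = 0 :=
    (mul_eq_zero.1 (show (t₀ - t₁) * (y 3 * (y 1 - y 0 - y 3 + y 4 - y 6)) = 0 by
      linear_combination e1 + e2)).resolve_left hs
  by_cases h6 : y 6 = 0
  · by_cases h5 : y 5 = 0
    -- This form vanishes on the conic and on component 2, but not identically on components 1 and
    -- 10. The next form, y₀ - y₂ + y₃, separates the conic from component 2.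
    · by_cases hl : y 1 - y 0 - y 3 + y 4 = 0
      · by_cases hm : y 0 - y 2 + y 3 = 0
        -- Witnesses are positions in `componentEqs`: 3 is the conic, and from 4 on the position is
        -- one less than the label.
        · refine ⟨3, ?_⟩
          simp [componentEqs]
          refine ⟨?_, h6, h5, by linear_combination hl + hm, hm⟩
          linear_combination e3 - (t₀ - t₁) * y 3 * h5
        · refine ⟨2, ?_⟩
          have g3 : y 3 = 0 := (mul_eq_zero.1 (show ((t₀ - t₁) * (y 0 - y 2 + y 3)) * y 3 = 0 by
            linear_combination e2 - e3 - (t₀ - t₁) * y 3 * hl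
              + (t₀ - t₁) * y 3 * h5)).resolve_left (mul_ne_zero hs hm)
          have g4 : y 4 = 0 := (mul_eq_zero.1 (show (t₁ * (y 0 - y 2 + y 3)) * y 4 = 0 by
            rw [g3] at e0 e3 ⊢
            linear_combination e0 + e3)).resolve_left
              (mul_ne_zero h_infty hm)
          simp [componentEqs]
          exact ⟨h6, h5, g4, g3, by linear_combination -hl - g3 + g4⟩
      · have g2 := (mul_eq_zero.1 f2).resolve_right hl
        rw [h6, sub_zero] at f3
        have g3 := (mul_eq_zero.1 f3).resolve_right hl
        have f4 : y 0 * y 4 = 0 := (mul_eq_zero.1 (show t₁ * (y 0 * y 4) = 0 by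
          linear_combination e0 + t₀ * y 1 * g3)).resolve_left h_infty
        rcases mul_eq_zero.1 f4 with g | g
        · refine ⟨9, ?_⟩
          simp [componentEqs]
          exact ⟨h6, h5, g3, g2, g⟩
        · refine ⟨1, ?_⟩
          simp [componentEqs]
          exact ⟨h6, h5, g, g3, g2⟩
    · have g0 := (mul_eq_zero.1 f1).resolve_right h5
      have g1 := (mul_eq_zero.1 e6).resolve_right h5
      have g34 : y 3 - y 4 = 0 := (mul_eq_zero.1 (show (y 3 - y 4) * y 5 = 0 by
        linear_combination e9 - y 4 * h6)).resolve_right h5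
      have f4 : y 3 * (y 2 - y 4 + y 5) = 0 :=
        (mul_eq_zero.1 (show (t₀ - t₁) * (y 3 * (y 2 - y 4 + y 5)) = 0 by
          linear_combination e3 - t₁ * y 2 * g34)).resolve_left hs
      rcases mul_eq_zero.1 f4 with g | g
      · refine ⟨10, ?_⟩
        simp [componentEqs]
        exact ⟨h6, by linear_combination g - g34, g, g1, g0⟩
      · refine ⟨4, ?_⟩
        simp [componentEqs]
        exact ⟨h6, g34, g, g1, g0⟩
  · have g1 := (mul_eq_zero.1 e8).resolve_right h6
    have g2 := (mul_eq_zero.1 e5).resolve_right h6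
    have f4 : y 0 * y 4 = 0 := (mul_eq_zero.1 (show t₁ * (y 0 * y 4) = 0 by
      linear_combination e0 + t₀ * y 3 * g1)).resolve_left h_infty
    have f5 : y 3 * (y 4 - y 5) = 0 := (mul_eq_zero.1 (show (t₀ - t₁) * (y 3 * (y 4 - y 5)) = 0 by
      linear_combination -e3 + (t₀ * y 3 - t₁ * y 4) * g2)).resolve_left hs
    by_cases h0 : y 0 = 0
    · by_cases h3 : y 3 = 0
      · have f6 : y 4 * (y 5 - y 6) = 0 := by linear_combination -e9 + y 5 * h3
        rcases mul_eq_zero.1 f6 with g | g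
        · refine ⟨7, ?_⟩
          simp [componentEqs]
          exact ⟨g, h3, g2, g1, h0⟩
        · refine ⟨6, ?_⟩
          simp [componentEqs]
          exact ⟨g, h3, g2, g1, h0⟩
      · refine ⟨5, ?_⟩
        have g45 := (mul_eq_zero.1 f5).resolve_left h3
        have g := (mul_eq_zero.1 f3).resolve_left h3
        simp [componentEqs]
        exact ⟨g45, by linear_combination -g + g1 - h0 + g45, g2, g1, h0⟩
    · have g4 := (mul_eq_zero.1 f4).resolve_left h0
      have g5 := (mul_eq_zero.1 f1).resolve_left h0
      rcases mul_eq_zero.1 f3 with g | g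
      · refine ⟨0, ?_⟩
        simp [componentEqs]
        exact ⟨g5, g4, g, g2, g1⟩
      · refine ⟨8, ?_⟩
        simp [componentEqs]
        exact ⟨g5, g4, g2, g1, by linear_combination -g + g1 + g4⟩

/-! ### The homogeneous ideal of the curve -/

/-- The coordinate ring of `ℙ⁶`. -/
abbrev CoordRing : Type := MvPolynomial (Fin 7) ℂ

/-- The ideal generated by finitely many polynomials. -/
abbrev idealOf {n : ℕ} (p : Fin n → CoordRing) : Ideal CoordRing := Ideal.span (Set.range p)

theorem mem_idealOf {n : ℕ} {p : Fin n → CoordRing} {f : CoordRing} :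
    f ∈ idealOf p ↔ ∃ c : Fin n → CoordRing, ∑ i, c i * p i = f :=
  Ideal.mem_span_range_iff_exists_fun

theorem idealOf_le {n : ℕ} {p : Fin n → CoordRing} {I : Ideal CoordRing} (h : ∀ i, p i ∈ I) :
    idealOf p ≤ I :=
  Ideal.span_le.2 (Set.range_subset_iff.2 h)

/-- The quotient map modulo `I` and its composite with the substitution agree on the variables,
hence everywhere. With σ a parametrization, this shows that polynomials vanishing on a line lie in
the ideal of its linear equations. -/
theorem sub_bind₁_mem {I : Ideal CoordRing} {σ : Fin 7 → CoordRing} (h : ∀ i, X i - σ i ∈ I)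
    (f : CoordRing) : f - bind₁ σ f ∈ I := by
  have h1 : (Ideal.Quotient.mkₐ ℂ I) = (Ideal.Quotient.mkₐ ℂ I).comp (bind₁ σ) := by
    refine MvPolynomial.algHom_ext fun i => ?_
    rw [AlgHom.comp_apply, bind₁_X_right]
    exact Ideal.Quotient.eq.2 (h i)
  exact Ideal.Quotient.eq.1 (DFunLike.congr_fun h1 f)

theorem mem_of_bind₁_eq_zero {I : Ideal CoordRing} {σ : Fin 7 → CoordRing}
    (h : ∀ i, X i - σ i ∈ I) {f : CoordRing} (hf : bind₁ σ f = 0) : f ∈ I := by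
  simpa [hf] using sub_bind₁_mem h f

theorem bind₁_eq_zero {σ : Fin 7 → CoordRing} {f : CoordRing}
    (h : ∀ y, eval (fun i => eval y (σ i)) f = 0) : bind₁ σ f = 0 := by
  refine MvPolynomial.funext fun y => ?_
  rw [map_zero, ← h y, eval, eval₂Hom_bind₁]
  rfl

theorem exists_sub_mul_mem {n : ℕ} {p : Fin n → CoordRing} {h f : CoordRing}
    (hf : f ∈ idealOf (Fin.cons h p)) : ∃ g, f - h * g ∈ idealOf p := by
  obtain ⟨c, rfl⟩ := mem_idealOf.1 hf
  refine ⟨c 0, ?_⟩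
  rw [Fin.sum_univ_succ]
  simp only [Fin.cons_zero, Fin.cons_succ]
  rw [mul_comm h, add_sub_cancel_left]
  exact mem_idealOf.2 ⟨_, rfl⟩

/-- If `h` times the ideal of a curve `B` is contained in an ideal, and the sum of the latter with
`(h)` contains the ideal of a curve `A`, then the former contains the ideal of `A ∪ B`. -/
theorem mem_idealOf_of_residual {n m k : ℕ} {p : Fin n → CoordRing} (a : Fin m → CoordRing)
    (b : Fin k → CoordRing) (h : CoordRing) {f : CoordRing}
    (ha : ∀ i, a i ∈ idealOf (Fin.cons h p)) (hb : ∀ i, h * b i ∈ idealOf p)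
    (hfa : f ∈ idealOf a) (hfb : ∀ g, f - h * g ∈ idealOf p → g ∈ idealOf b) : f ∈ idealOf p := by
  -- Since f lies in (a) ⊆ (h, p), f = h g modulo (p). The residual hypothesis puts g in (b), and h
  -- · (b) ⊆ (p), so h g and f lie in (p).
  obtain ⟨g, hg⟩ := exists_sub_mul_mem (idealOf_le ha hfa)
  have h1 : h * g ∈ idealOf p := by
    obtain ⟨c, rfl⟩ := mem_idealOf.1 (hfb g hg)
    rw [Finset.mul_sum]
    refine Ideal.sum_mem _ fun i _ => ?_
    rw [mul_left_comm]
    exact Ideal.mul_mem_left _ _ (hb i)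
  simpa using Ideal.add_mem _ hg h1

/-- On the parametrized line, f and all of `p` vanish, hence so does h g. The form h does not vanish
there, and the polynomial ring is a domain. -/
theorem residual_vanishes {n : ℕ} {p : Fin n → CoordRing} {σ : Fin 7 → CoordRing}
    {f g h : CoordRing} (hp : ∀ i, bind₁ σ (p i) = 0) (hf : bind₁ σ f = 0) (hh : bind₁ σ h ≠ 0)
    (hg : f - h * g ∈ idealOf p) : bind₁ σ g = 0 := by
  have h1 : bind₁ σ (f - h * g) = 0 := by
    obtain ⟨c, hc⟩ := mem_idealOf.1 hg
    rw [← hc, map_sum]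
    exact Finset.sum_eq_zero fun i _ => by rw [map_mul, hp, mul_zero]
  rw [map_sub, map_mul, hf, zero_sub, neg_eq_zero] at h1
  exact (mul_eq_zero.1 h1).resolve_left hh

/-! Parametrizations of the lines, labelled like the components of the curve. -/

def line0 : Fin 7 → CoordRing := ![X 0, 0, 0, 0, 0, 0, X 6]
def line1 : Fin 7 → CoordRing := ![X 0, X 1, 0, 0, 0, 0, 0]
def line2 : Fin 7 → CoordRing := ![X 0, X 0, X 2, 0, 0, 0, 0]
def line5 : Fin 7 → CoordRing := ![0, 0, X 3 - X 5, X 3, X 3, X 5, 0]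
def line6 : Fin 7 → CoordRing := ![0, 0, 0, X 5 - X 6, X 5, X 5, X 6]
def line7 : Fin 7 → CoordRing := ![0, 0, 0, 0, X 4, X 5, X 5]
def line8 : Fin 7 → CoordRing := ![0, 0, 0, 0, 0, X 5, X 6]
def line9 : Fin 7 → CoordRing := ![-(X 3 + X 6), 0, 0, X 3, 0, 0, X 6]
def line10 : Fin 7 → CoordRing := ![0, X 1, 0, 0, X 4, 0, 0]
def line11 : Fin 7 → CoordRing := ![0, 0, X 2, 0, 0, X 5, 0]

theorem mem_of_C_mul_mem {I : Ideal CoordRing} {a : ℂ} (ha : a ≠ 0) {f : CoordRing}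
    (h : C a * f ∈ I) : f ∈ I := by
  have h1 := I.mul_mem_left (C a⁻¹) h
  rwa [← mul_assoc, ← C_mul, inv_mul_cancel₀ ha, C_1, one_mul] at h1

/-! ### Ideals of the components outside the hyperplane y₆ = 0 -/

theorem mem_of_vanishes_seven_eight {f : CoordRing}
    (h7 : bind₁ line7 f = 0) (h8 : bind₁ line8 f = 0) :
    f ∈ idealOf ![X 0, X 1, X 2, X 3, X 4 * (X 5 - X 6)] := by
  refine mem_idealOf_of_residual
    ![X 0, X 1, X 2, X 3, X 4]
    ![X 0, X 1, X 2, X 3, X 5 - X 6]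
    (X 4) ?_ ?_ ?_ fun g hg => ?_
  -- Each row lists the coefficients of one generator of A; entry 0 belongs to h, which `Fin.cons`
  -- puts in front of `p`. The next bullet expresses the products h · bᵢ through `p`.
  · exact fun i => mem_idealOf.2 ⟨(![![0, 1, 0, 0, 0, 0], ![0, 0, 1, 0, 0, 0], ![0, 0, 0, 1, 0,
      0], ![0, 0, 0, 0, 1, 0], ![1, 0, 0, 0, 0, 0]] : Fin 5 → Fin 6 → CoordRing) i, by fin_cases i
      <;> simp [Fin.sum_univ_succ]⟩
  · exact fun i => mem_idealOf.2 ⟨(![![X 4, 0, 0, 0, 0], ![0, X 4, 0, 0, 0], ![0, 0, X 4, 0, 0],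
      ![0, 0, 0, X 4, 0], ![0, 0, 0, 0, 1]] : Fin 5 → Fin 5 → CoordRing) i, by fin_cases i <;>
      simp [Fin.sum_univ_succ]⟩
  · refine mem_of_bind₁_eq_zero (σ := line8) (fun i => mem_idealOf.2 ⟨(![![1, 0, 0, 0, 0], ![0, 1,
        0, 0, 0], ![0, 0, 1, 0, 0], ![0, 0, 0, 1, 0], ![0, 0, 0, 0, 1], ![0, 0, 0, 0, 0], ![0, 0,
        0, 0, 0]] : Fin 7 → Fin 5 → CoordRing) i, ?_⟩) h8
    fin_cases i <;> simp [Fin.sum_univ_succ, line8]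
  -- The powers of two are merely a test point at which the pullback of h to the line is nonzero.
  · refine mem_of_bind₁_eq_zero (σ := line7) (fun i => mem_idealOf.2 ⟨(![![1, 0, 0, 0, 0], ![0, 1,
        0, 0, 0], ![0, 0, 1, 0, 0], ![0, 0, 0, 1, 0], ![0, 0, 0, 0, 0], ![0, 0, 0, 0, 0], ![0, 0,
        0, 0, -1]] : Fin 7 → Fin 5 → CoordRing) i, ?_⟩) (residual_vanishes (σ := line7) (fun i =>
        by fin_cases i <;> simp [line7]) h7 (fun e => absurd (congrArg (eval ![1, 2, 4, 8, 16, 32,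
            64]) e) (by simp [line7])) hg)
    fin_cases i <;> simp [Fin.sum_univ_succ, line7]

theorem mem_of_vanishes_six_seven_eight {f : CoordRing}
    (h6 : bind₁ line6 f = 0) (h7 : bind₁ line7 f = 0) (h8 : bind₁ line8 f = 0) :
    f ∈ idealOf ![X 0, X 1, X 2, X 3 * (X 4 - X 5), X 3 * X 5 - X 4 * X 5 + X 4 * X 6, X 3 * (X 3 -
        X 4 + X 6)] := by
  refine mem_idealOf_of_residual
    ![X 0, X 1, X 2, X 3, X 4 * (X 5 - X 6)]
    ![X 0, X 1, X 2, X 4 - X 5, X 3 - X 5 + X 6]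
    (X 3) ?_ ?_ ?_ fun g hg => ?_
  · exact fun i => mem_idealOf.2 ⟨(![![0, 1, 0, 0, 0, 0, 0], ![0, 0, 1, 0, 0, 0, 0], ![0, 0, 0, 1,
      0, 0, 0], ![1, 0, 0, 0, 0, 0, 0], ![X 5, 0, 0, 0, 0, -1, 0]] : Fin 5 → Fin 7 → CoordRing) i,
      by fin_cases i <;> simp [Fin.sum_univ_succ] <;> ring⟩
  · exact fun i => mem_idealOf.2 ⟨(![![X 3, 0, 0, 0, 0, 0], ![0, X 3, 0, 0, 0, 0], ![0, 0, X 3, 0,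
      0, 0], ![0, 0, 0, 1, 0, 0], ![0, 0, 0, 1, 0, 1]] : Fin 5 → Fin 6 → CoordRing) i, by
      fin_cases i <;> simp [Fin.sum_univ_succ] <;> ring⟩
  · exact mem_of_vanishes_seven_eight h7 h8
  · refine mem_of_bind₁_eq_zero (σ := line6) (fun i => mem_idealOf.2 ⟨(![![1, 0, 0, 0, 0], ![0, 1,
        0, 0, 0], ![0, 0, 1, 0, 0], ![0, 0, 0, 0, 1], ![0, 0, 0, 1, 0], ![0, 0, 0, 0, 0], ![0, 0,
        0, 0, 0]] : Fin 7 → Fin 5 → CoordRing) i, ?_⟩) (residual_vanishes (σ := line6) (fun i =>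
        by fin_cases i <;> simp [line6] <;> ring) h6 (fun e => absurd (congrArg (eval ![1, 2, 4, 8,
            16, 32, 64]) e) (by simp [line6] <;> norm_num)) hg)
    fin_cases i <;> simp [Fin.sum_univ_succ, line6] <;> ring

theorem mem_of_vanishes_zero_nine {f : CoordRing}
    (h0 : bind₁ line0 f = 0) (h9 : bind₁ line9 f = 0) :
    f ∈ idealOf ![X 1, X 2, X 4, X 5, X 3 * (X 0 + X 3 + X 6)] := by
  refine mem_idealOf_of_residual
    ![X 1, X 2, X 3, X 4, X 5]
    ![X 1, X 2, X 4, X 5, X 0 + X 3 + X 6]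
    (X 3) ?_ ?_ ?_ fun g hg => ?_
  · exact fun i => mem_idealOf.2 ⟨(![![0, 1, 0, 0, 0, 0], ![0, 0, 1, 0, 0, 0], ![1, 0, 0, 0, 0,
      0], ![0, 0, 0, 1, 0, 0], ![0, 0, 0, 0, 1, 0]] : Fin 5 → Fin 6 → CoordRing) i, by fin_cases i
      <;> simp [Fin.sum_univ_succ]⟩
  · exact fun i => mem_idealOf.2 ⟨(![![X 3, 0, 0, 0, 0], ![0, X 3, 0, 0, 0], ![0, 0, X 3, 0, 0],
      ![0, 0, 0, X 3, 0], ![0, 0, 0, 0, 1]] : Fin 5 → Fin 5 → CoordRing) i, by fin_cases i <;>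
      simp [Fin.sum_univ_succ]⟩
  · refine mem_of_bind₁_eq_zero (σ := line0) (fun i => mem_idealOf.2 ⟨(![![0, 0, 0, 0, 0], ![1, 0,
        0, 0, 0], ![0, 1, 0, 0, 0], ![0, 0, 1, 0, 0], ![0, 0, 0, 1, 0], ![0, 0, 0, 0, 1], ![0, 0,
        0, 0, 0]] : Fin 7 → Fin 5 → CoordRing) i, ?_⟩) h0
    fin_cases i <;> simp [Fin.sum_univ_succ, line0]
  · refine mem_of_bind₁_eq_zero (σ := line9) (fun i => mem_idealOf.2 ⟨(![![0, 0, 0, 0, 1], ![1, 0,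
        0, 0, 0], ![0, 1, 0, 0, 0], ![0, 0, 0, 0, 0], ![0, 0, 1, 0, 0], ![0, 0, 0, 1, 0], ![0, 0,
        0, 0, 0]] : Fin 7 → Fin 5 → CoordRing) i, ?_⟩) (residual_vanishes (σ := line9) (fun i =>
        by fin_cases i <;> simp [line9]) h9 (fun e => absurd (congrArg (eval ![1, 2, 4, 8, 16, 32,
            64]) e) (by simp [line9])) hg)
    fin_cases i <;> simp [Fin.sum_univ_succ, line9] <;> ring

theorem mem_of_vanishes_pentagon {f : CoordRing}
    (h0 : bind₁ line0 f = 0) (h6 : bind₁ line6 f = 0) (h7 : bind₁ line7 f = 0) (h8 : bind₁ line8 f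
    = 0) (h9 : bind₁ line9 f = 0) :
    f ∈ idealOf ![X 1, X 2, X 0 * X 5, X 0 * X 4, X 3 * (X 4 - X 5), X 3 * X 5 - X 4 * X 5 + X 4 *
        X 6, X 3 * (X 3
      + X 0 - X 4 + X 6)] := by
  refine mem_idealOf_of_residual
    ![X 0, X 1, X 2, X 3 * (X 4 - X 5), X 3 * X 5 - X 4 * X 5 + X 4 * X 6, X 3 * (X 3 - X 4 + X
      6)]
    ![X 1, X 2, X 4, X 5, X 3 * (X 0 + X 3 + X 6)]
    (X 0) ?_ ?_ ?_ fun g hg => ?_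
  · exact fun i => mem_idealOf.2 ⟨(![![1, 0, 0, 0, 0, 0, 0, 0], ![0, 1, 0, 0, 0, 0, 0, 0], ![0, 0,
      1, 0, 0, 0, 0, 0], ![0, 0, 0, 0, 0, 1, 0, 0], ![0, 0, 0, 0, 0, 0, 1, 0], ![-X 3, 0, 0, 0, 0,
      0, 0, 1]] : Fin 6 → Fin 8 → CoordRing) i, by fin_cases i <;> simp [Fin.sum_univ_succ] <;>
      ring⟩
  · exact fun i => mem_idealOf.2 ⟨(![![X 0, 0, 0, 0, 0, 0, 0], ![0, X 0, 0, 0, 0, 0, 0], ![0, 0,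
      0, 1, 0, 0, 0], ![0, 0, 1, 0, 0, 0, 0], ![0, 0, 0, X 3, 0, 0, X 0]] : Fin 5 → Fin 7 →
      CoordRing) i, by fin_cases i <;> simp [Fin.sum_univ_succ] <;> ring⟩
  · exact mem_of_vanishes_six_seven_eight h6 h7 h8
  · exact mem_of_vanishes_zero_nine (residual_vanishes (σ := line0) (fun i => by fin_cases i <;>
        simp [line0]) h0 (fun e => absurd (congrArg (eval ![1, 2, 4, 8, 16, 32, 64]) e) (by simp
            [line0])) hg) (residual_vanishes (σ := line9) (fun i => by
        fin_cases i <;> simp [line9]) h9 (fun e => absurd (congrArg (eval ![1, 2, 4, 8, 16, 32,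
            64]) e) (by simp [line9] <;> norm_num)) hg)

/-! ### The ideal of the conic -/

/-- The equations of the conic. -/
def OnConic (t₀ t₁ : ℂ) (y : Fin 7 → ℂ) : Prop :=
  y 5 = 0 ∧ y 6 = 0 ∧ y 1 = y 2 - y 4 ∧ y 0 = y 2 - y 3 ∧
    t₀ * y 2 * y 3 - t₁ * y 2 * y 4 - (t₀ - t₁) * y 3 * y 4 = 0

/-- Generators of the ideal of the conic. -/
abbrev conicGens (t₀ t₁ : ℂ) : Fin 5 → CoordRing :=
  ![X 5, X 6, X 1 - X 2 + X 4, X 0 - X 2 + X 3,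
    C t₀ * X 2 * X 3 - C t₁ * X 2 * X 4 - (C t₀ - C t₁) * X 3 * X 4]

theorem mem_of_vanishes_conic_zero {t₁ : ℂ} (h_infty : t₁ ≠ 0) {f : CoordRing}
    (hc : ∀ y, OnConic 0 t₁ y → eval y f = 0) : f ∈ idealOf (conicGens 0 t₁) := by
  -- For t₀ = 0 the quadratic equation is -t₁ y₄ (y₂ - y₃). The maps σ and τ parametrize the lines
  -- y₄ = 0 and y₂ = y₃, which are separated by h = X 4.
  let σ : Fin 7 → CoordRing := ![X 2 - X 3, X 2, X 2, X 3, 0, 0, 0]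
  let τ : Fin 7 → CoordRing := ![0, X 2 - X 4, X 2, X 2, X 4, 0, 0]
  have hσ : bind₁ σ f = 0 := bind₁_eq_zero fun y => hc _ (by simp [OnConic, σ])
  have hτ : bind₁ τ f = 0 := bind₁_eq_zero fun y => hc _ (by simp [OnConic, τ])
  refine mem_idealOf_of_residual
    ![X 5, X 6, X 1 - X 2 + X 4, X 0 - X 2 + X 3, X 4]
    ![X 5, X 6, X 1 - X 2 + X 4, X 0 - X 2 + X 3, X 2 - X 3] (X 4) ?_ ?_ ?_ fun g hg => ?_
  · exact fun i => mem_idealOf.2 ⟨(![![0, 1, 0, 0, 0, 0], ![0, 0, 1, 0, 0, 0], ![0, 0, 0, 1, 0, 0],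
      ![0, 0, 0, 0, 1, 0], ![1, 0, 0, 0, 0, 0]] : Fin 5 → Fin 6 → CoordRing) i, by
        fin_cases i <;> simp [Fin.sum_univ_succ]⟩
  · intro i
    refine mem_of_C_mul_mem h_infty (mem_idealOf.2 ⟨(![![C t₁ * X 4, 0, 0, 0, 0],
      ![0, C t₁ * X 4, 0, 0, 0], ![0, 0, C t₁ * X 4, 0, 0], ![0, 0, 0, C t₁ * X 4, 0],
      ![0, 0, 0, 0, -1]] : Fin 5 → Fin 5 → CoordRing) i, ?_⟩)
    fin_cases i <;> simp [Fin.sum_univ_succ] <;> ring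
  · refine mem_of_bind₁_eq_zero (fun i => mem_idealOf.2 ⟨(![![0, 0, 0, 1, 0], ![0, 0, 1, 0, -1], 0,
      0, ![0, 0, 0, 0, 1], ![1, 0, 0, 0, 0], ![0, 1, 0, 0, 0]] : Fin 7 → Fin 5 → CoordRing) i, ?_⟩)
      hσ
    fin_cases i <;> simp [Fin.sum_univ_succ, σ] <;> ring
  · refine mem_of_bind₁_eq_zero (fun i => mem_idealOf.2 ⟨(![![0, 0, 0, 1, 1], ![0, 0, 1, 0, 0], 0,
      ![0, 0, 0, 0, -1], 0, ![1, 0, 0, 0, 0], ![0, 1, 0, 0, 0]] : Fin 7 → Fin 5 → CoordRing) i, ?_⟩)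
      (residual_vanishes (σ := τ) (fun i => by fin_cases i <;> simp [τ]) hτ
        (by simp [τ]) hg)
    fin_cases i <;> simp [Fin.sum_univ_succ, τ] <;> ring

/-- The form c = t₀ X₃ - t₁ X₄ is a nonzerodivisor modulo the conic. The substitution θ eliminates
the linear equations, leaving c f = d q in the plane. On c = 0, imposed by κ, the equation q becomes
-(t₀ - t₁)(t₁/t₀) X₄² ≠ 0; so c divides d and can be cancelled. -/
theorem mem_of_mul_mem_conic {t₀ t₁ : ℂ} (h_zero : t₀ ≠ 0) (h_one : t₀ ≠ t₁) (h_infty : t₁ ≠ 0)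
    {f : CoordRing} (hf : (C t₀ * X 3 - C t₁ * X 4) * f ∈ idealOf (conicGens t₀ t₁)) :
    f ∈ idealOf (conicGens t₀ t₁) := by
  let θ : Fin 7 → CoordRing := ![X 2 - X 3, X 2 - X 4, X 2, X 3, X 4, 0, 0]
  let κ : Fin 7 → CoordRing := ![X 0, X 1, X 2, C (t₁ / t₀) * X 4, X 4, X 5, X 6]
  obtain ⟨d, hd⟩ := mem_idealOf.1 hf
  have h1 := congrArg (bind₁ θ) hd
  simp [Fin.sum_univ_succ, θ, algHom_C] at h1
  have h2 := congrArg (bind₁ κ) h1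
  have hC : (C t₀ * (C (t₁ / t₀) * X 4) : CoordRing) = C t₁ * X 4 := by
    rw [← mul_assoc, ← C_mul, mul_div_cancel₀ _ h_zero]
  simp [κ, hC] at h2
  have h3 : bind₁ κ (bind₁ θ (d 4)) = 0 := by
    refine h2.resolve_right fun e => ?_
    have e' := congrArg (eval (Pi.single 4 1)) e
    simp [h_zero, h_infty, sub_ne_zero.2 h_one] at e'
  have h4 : bind₁ θ (d 4) ∈ idealOf ![C t₀ * X 3 - C t₁ * X 4] := by
    refine mem_of_bind₁_eq_zero (fun i => mem_of_C_mul_mem h_zero (mem_idealOf.2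
      ⟨(![0, 0, 0, ![1], 0, 0, 0] : Fin 7 → Fin 1 → CoordRing) i, ?_⟩)) h3
    fin_cases i <;> simp [κ, mul_sub, hC]
  obtain ⟨e, he⟩ := mem_idealOf.1 h4
  rw [Fin.sum_univ_one] at he
  have hc0 : (C t₀ * X 3 - C t₁ * X 4 : CoordRing) ≠ 0 := fun e => h_zero (by
    simpa using congrArg (eval (Pi.single 3 1)) e)
  have h5 : bind₁ θ f = e 0 * conicGens t₀ t₁ 4 := by
    refine mul_left_cancel₀ hc0 (h1.symm.trans ?_)
    refine (congrArg (· * _) he.symm).trans ?_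
    simp only [Matrix.cons_val]
    ring
  have h6 : f - bind₁ θ f ∈ idealOf (conicGens t₀ t₁) := by
    refine sub_bind₁_mem (fun i => mem_idealOf.2 ⟨(![![0, 0, 0, 1, 0], ![0, 0, 1, 0, 0], 0, 0, 0,
      ![1, 0, 0, 0, 0], ![0, 1, 0, 0, 0]] : Fin 7 → Fin 5 → CoordRing) i, ?_⟩) f
    fin_cases i <;> simp [Fin.sum_univ_succ, θ] <;> ring
  have h7 : bind₁ θ f ∈ idealOf (conicGens t₀ t₁) := by
    rw [h5]
    exact Ideal.mul_mem_left _ _ (Ideal.subset_span ⟨4, rfl⟩)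
  simpa using Ideal.add_mem _ h6 h7

/-- The conic equation reads c X₂ = (t₀ - t₁) X₃ X₄ with c = t₀ X₃ - t₁ X₄, so powers of c eliminate
X₀, X₁, X₂ in favour of X₃, X₄. -/
theorem exists_pow_mul_sub_mem_conic {t₀ t₁ : ℂ} (f : CoordRing) : ∃ (N : ℕ) (r : CoordRing),
    bind₁ ![0, 0, 0, X 3, X 4, 0, 0] r = r ∧
      (C t₀ * X 3 - C t₁ * X 4) ^ N * f - r ∈ idealOf (conicGens t₀ t₁) := by
  set τ : Fin 7 → CoordRing := ![0, 0, 0, X 3, X 4, 0, 0] with hτ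
  set c : CoordRing := C t₀ * X 3 - C t₁ * X 4 with hc
  have hτc : bind₁ τ c = c := by simp [hc, hτ]
  induction f using MvPolynomial.induction_on with
  | C a => exact ⟨0, C a, by simp, by simp⟩
  | add f g hf hg =>
    obtain ⟨N, r, hr, hf⟩ := hf
    obtain ⟨M, s, hs, hg⟩ := hg
    refine ⟨N + M, c ^ M * r + c ^ N * s, by simp [hr, hs, hτc], ?_⟩
    rw [show c ^ (N + M) * (f + g) - (c ^ M * r + c ^ N * s) =
      c ^ M * (c ^ N * f - r) + c ^ N * (c ^ M * g - s) by ring]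
    exact Ideal.add_mem _ (Ideal.mul_mem_left _ _ hf) (Ideal.mul_mem_left _ _ hg)
  | mul_X f n hf =>
    obtain ⟨N, r, hr, hf⟩ := hf
    obtain ⟨k, hk, hkn⟩ : ∃ k, bind₁ τ k = k ∧ c * X n - k ∈ idealOf (conicGens t₀ t₁) := by
      let S : CoordRing := C t₀ - C t₁
      refine ⟨(![S * X 3 * X 4 - c * X 3, S * X 3 * X 4 - c * X 4, S * X 3 * X 4, c * X 3, c * X 4,
        0, 0] : Fin 7 → CoordRing) n, ?_, mem_idealOf.2 ⟨(![![0, 0, 0, c, 1], ![0, 0, c, 0, 1],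
        ![0, 0, 0, 0, 1], 0, 0, ![c, 0, 0, 0, 0], ![0, c, 0, 0, 0]] :
        Fin 7 → Fin 5 → CoordRing) n, ?_⟩⟩
      · fin_cases n <;> simp [hτc] <;> simp [S, hτ]
      · fin_cases n <;> simp [Fin.sum_univ_succ, S, hc] <;> ring
    refine ⟨N + 1, r * k, by simp [hr, hk], ?_⟩
    rw [show c ^ (N + 1) * (f * X n) - r * k = c * X n * (c ^ N * f - r) + r * (c * X n - k) by
        ring]
    exact Ideal.add_mem _ (Ideal.mul_mem_left _ _ hf) (Ideal.mul_mem_left _ _ hkn)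

theorem eval_eq_zero_of_mem_conic {t₀ t₁ : ℂ} {f : CoordRing} (hf : f ∈ idealOf (conicGens t₀ t₁))
    {y : Fin 7 → ℂ} (hy : OnConic t₀ t₁ y) : eval y f = 0 := by
  obtain ⟨h5, h6, h1, h0, hq⟩ := hy
  obtain ⟨d, rfl⟩ := mem_idealOf.1 hf
  rw [map_sum]
  refine Finset.sum_eq_zero fun i _ => ?_
  rw [map_mul]
  refine mul_eq_zero_of_right _ ?_
  fin_cases i <;> simp [h5, h6, h1, h0, hq]

/-- For t₀ ≠ 0, any (y₃, y₄) with c ≠ 0 lifts to the cone over the conic. Hence the remainder r in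
X₃, X₄ vanishes wherever c ≠ 0, so c r = 0 and r = 0. The power of c is then cancelled. For t₀ = 0
the form c is a zero divisor, so the pair of lines is treated separately. -/
theorem mem_of_vanishes_conic {t₀ t₁ : ℂ} (h_one : t₀ ≠ t₁) (h_infty : t₁ ≠ 0) {f : CoordRing}
    (hc : ∀ y, OnConic t₀ t₁ y → eval y f = 0) : f ∈ idealOf (conicGens t₀ t₁) := by
  by_cases h_zero : t₀ = 0
  · subst h_zero
    exact mem_of_vanishes_conic_zero h_infty hc
  obtain ⟨N, r, hr, hf⟩ := exists_pow_mul_sub_mem_conic (t₀ := t₀) (t₁ := t₁) f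
  have hr' : ∀ y : Fin 7 → ℂ, eval y r = eval ![0, 0, 0, y 3, y 4, 0, 0] r := by
    intro y
    conv_lhs => rw [← hr]
    rw [eval, eval₂Hom_bind₁]
    refine congrArg (fun z => eval₂Hom (RingHom.id ℂ) z r) ?_
    ext i
    fin_cases i <;> simp
  have hr0 : r = 0 := by
    have h : (C t₀ * X 3 - C t₁ * X 4) * r = 0 := by
      refine MvPolynomial.funext fun z => ?_
      by_cases hz : t₀ * z 3 - t₁ * z 4 = 0
      · simp [hz]
      let w := (t₀ - t₁) * z 3 * z 4 / (t₀ * z 3 - t₁ * z 4)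
      have hy : OnConic t₀ t₁ ![w - z 3, w - z 4, w, z 3, z 4, 0, 0] := by
        simp only [OnConic, Matrix.cons_val, true_and, w]
        field_simp
        ring
      have h := eval_eq_zero_of_mem_conic hf hy
      rw [map_sub, map_mul, hc _ hy, mul_zero, zero_sub, neg_eq_zero, hr'] at h
      rw [map_mul, hr' z, map_zero]
      exact mul_eq_zero_of_right _ h
    refine (mul_eq_zero.1 h).resolve_left fun e => h_zero ?_
    simpa using congrArg (eval (Pi.single 3 1)) e
  rw [hr0, sub_zero] at hf
  clear hr hr' hr0
  induction N with
  | zero => simpa using hf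
  | succ N ih =>
    rw [pow_succ', mul_assoc] at hf
    exact ih (mem_of_mul_mem_conic h_zero h_one h_infty hf)

/-! ### Ideals of the unions inside the hyperplane y₆ = 0 -/

theorem mem_of_vanishes_two_conic {t₀ t₁ : ℂ} (h_one : t₀ ≠ t₁) (h_infty : t₁ ≠ 0) {f : CoordRing}
    (hc : ∀ y, OnConic t₀ t₁ y → eval y f = 0) (h2 : bind₁ line2 f = 0) :
    f ∈ idealOf ![X 5, X 6, X 1 - X 0 - X 3 + X 4, (X 0 - X 2 + X 3) * X 3, (X 0 - X 2 + X 3) * X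
        4, C t₀ * X 2 *
      X 3 - C t₁ * X 2 * X 4 - (C t₀ - C t₁) * X 3 * X 4] := by
  refine mem_idealOf_of_residual
    ![X 5, X 6, X 1 - X 2 + X 4, X 0 - X 2 + X 3, C t₀ * X 2 * X 3 - C t₁ * X 2 * X 4 - (C t₀ - C
      t₁) * X 3 * X 4]
    ![X 3, X 4, X 5, X 6, X 0 - X 1]
    (X 0 - X 2 + X 3) ?_ ?_ ?_ fun g hg => ?_
  · exact fun i => mem_idealOf.2 ⟨(![![0, 1, 0, 0, 0, 0, 0], ![0, 0, 1, 0, 0, 0, 0], ![1, 0, 0, 1,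
      0, 0, 0], ![1, 0, 0, 0, 0, 0, 0], ![0, 0, 0, 0, 0, 0, 1]] : Fin 5 → Fin 7 → CoordRing) i, by
      fin_cases i <;> simp [Fin.sum_univ_succ] <;> ring⟩
  · exact fun i => mem_idealOf.2 ⟨(![![0, 0, 0, 1, 0, 0], ![0, 0, 0, 0, 1, 0], ![X 0 - X 2 + X 3,
      0, 0, 0, 0, 0], ![0, X 0 - X 2 + X 3, 0, 0, 0, 0], ![0, 0, -(X 0 - X 2 + X 3), -1, 1, 0]] :
      Fin 5 → Fin 6 → CoordRing) i, by fin_cases i <;> simp [Fin.sum_univ_succ] <;> ring⟩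
  · exact mem_of_vanishes_conic h_one h_infty hc
  · refine mem_of_bind₁_eq_zero (σ := line2) (fun i => mem_idealOf.2 ⟨(![![0, 0, 0, 0, 0], ![0, 0,
        0, 0, -1], ![0, 0, 0, 0, 0], ![1, 0, 0, 0, 0], ![0, 1, 0, 0, 0], ![0, 0, 1, 0, 0], ![0, 0,
        0, 1, 0]] : Fin 7 → Fin 5 → CoordRing) i, ?_⟩) (residual_vanishes (σ := line2) (fun i =>
        by fin_cases i <;> simp [line2]) h2 (fun e => absurd (congrArg (eval ![1, 2, 4, 8, 16, 32,
            64]) e) (by simp [line2] <;> norm_num)) hg)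
    fin_cases i <;> simp [Fin.sum_univ_succ, line2]

theorem mem_of_vanishes_one_ten {f : CoordRing}
    (h1 : bind₁ line1 f = 0) (h10 : bind₁ line10 f = 0) :
    f ∈ idealOf ![X 2, X 3, X 5, X 6, X 0 * X 4] := by
  refine mem_idealOf_of_residual
    ![X 2, X 3, X 4, X 5, X 6]
    ![X 0, X 2, X 3, X 5, X 6]
    (X 4) ?_ ?_ ?_ fun g hg => ?_
  · exact fun i => mem_idealOf.2 ⟨(![![0, 1, 0, 0, 0, 0], ![0, 0, 1, 0, 0, 0], ![1, 0, 0, 0, 0,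
      0], ![0, 0, 0, 1, 0, 0], ![0, 0, 0, 0, 1, 0]] : Fin 5 → Fin 6 → CoordRing) i, by fin_cases i
      <;> simp [Fin.sum_univ_succ]⟩
  · exact fun i => mem_idealOf.2 ⟨(![![0, 0, 0, 0, 1], ![X 4, 0, 0, 0, 0], ![0, X 4, 0, 0, 0],
      ![0, 0, X 4, 0, 0], ![0, 0, 0, X 4, 0]] : Fin 5 → Fin 5 → CoordRing) i, by fin_cases i <;>
      simp [Fin.sum_univ_succ] <;> ring⟩
  · refine mem_of_bind₁_eq_zero (σ := line1) (fun i => mem_idealOf.2 ⟨(![![0, 0, 0, 0, 0], ![0, 0,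
        0, 0, 0], ![1, 0, 0, 0, 0], ![0, 1, 0, 0, 0], ![0, 0, 1, 0, 0], ![0, 0, 0, 1, 0], ![0, 0,
        0, 0, 1]] : Fin 7 → Fin 5 → CoordRing) i, ?_⟩) h1
    fin_cases i <;> simp [Fin.sum_univ_succ, line1]
  · refine mem_of_bind₁_eq_zero (σ := line10) (fun i => mem_idealOf.2 ⟨(![![1, 0, 0, 0, 0], ![0,
        0, 0, 0, 0], ![0, 1, 0, 0, 0], ![0, 0, 1, 0, 0], ![0, 0, 0, 0, 0], ![0, 0, 0, 1, 0], ![0,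
        0, 0, 0, 1]] : Fin 7 → Fin 5 → CoordRing) i, ?_⟩) (residual_vanishes (σ := line10) (fun i
        => by fin_cases i <;> simp [line10]) h10 (fun e => absurd (congrArg (eval ![1, 2, 4, 8, 16,
            32, 64]) e) (by simp [line10])) hg)
    fin_cases i <;> simp [Fin.sum_univ_succ, line10]

theorem mem_of_vanishes_one_two_ten_conic {t₀ t₁ : ℂ} (h_one : t₀ ≠ t₁) (h_infty : t₁ ≠ 0) {f :
    CoordRing}
    (hc : ∀ y, OnConic t₀ t₁ y → eval y f = 0) (h1 : bind₁ line1 f = 0) (h2 : bind₁ line2 f = 0)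
    (h10 : bind₁ line10 f = 0) :
    f ∈ idealOf ![X 5, X 6, X 2 * (X 1 - X 0 - X 3 + X 4), X 3 * (X 1 - X 0 - X 3 + X 4), C t₁ * X
        0 * X 4 - C t₀
      * X 1 * X 3, (C t₀ - C t₁) * X 1 * X 3 + C t₁ * X 2 * (X 3 - X 4), C t₀ * X 2 * X 3 - C t₁ *
      X 2 * X 4 - (C t₀ - C t₁) * X 3 * X 4] := by
  refine mem_idealOf_of_residual
    ![X 5, X 6, X 1 - X 0 - X 3 + X 4, (X 0 - X 2 + X 3) * X 3, (X 0 - X 2 + X 3) * X 4, C t₀ * X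
      2 * X 3 - C t₁ * X 2 * X 4 - (C t₀ - C t₁) * X 3 * X 4]
    ![X 2, X 3, X 5, X 6, X 0 * X 4]
    (X 1 - X 0 - X 3 + X 4) ?_ ?_ ?_ fun g hg => ?_
  · intro i
    fin_cases i
    · refine mem_idealOf.2 ⟨![0, 1, 0, 0, 0, 0, 0, 0], ?_⟩
      simp [Fin.sum_univ_succ]
    · refine mem_idealOf.2 ⟨![0, 0, 1, 0, 0, 0, 0, 0], ?_⟩
      simp [Fin.sum_univ_succ]
    · refine mem_idealOf.2 ⟨![1, 0, 0, 0, 0, 0, 0, 0], ?_⟩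
      simp [Fin.sum_univ_succ]
    -- Here and below, some generators are obtained only after multiplication by t₀ - t₁ or t₁;
    -- these are units because t ≠ 1, ∞.
    · refine mem_of_C_mul_mem (sub_ne_zero.2 h_one) (mem_idealOf.2 ⟨![0, 0, 0, 0, -(C t₀ - C t₁),
        0, 1, -1], ?_⟩)
      simp [Fin.sum_univ_succ] <;> ring
    · refine mem_of_C_mul_mem (mul_ne_zero (sub_ne_zero.2 h_one) h_infty) (mem_idealOf.2 ⟨![0, 0,
        0, 0, 0, (C t₀ - C t₁), C t₀, -C t₁], ?_⟩)
      simp [Fin.sum_univ_succ] <;> ring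
    · refine mem_idealOf.2 ⟨![0, 0, 0, 0, 0, 0, 0, 1], ?_⟩
      simp [Fin.sum_univ_succ]
  · intro i
    fin_cases i
    · refine mem_idealOf.2 ⟨![0, 0, 1, 0, 0, 0, 0], ?_⟩
      simp [Fin.sum_univ_succ] <;> ring
    · refine mem_idealOf.2 ⟨![0, 0, 0, 1, 0, 0, 0], ?_⟩
      simp [Fin.sum_univ_succ] <;> ring
    · refine mem_idealOf.2 ⟨![X 1 - X 0 - X 3 + X 4, 0, 0, 0, 0, 0, 0], ?_⟩
      simp [Fin.sum_univ_succ]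
    · refine mem_idealOf.2 ⟨![0, X 1 - X 0 - X 3 + X 4, 0, 0, 0, 0, 0], ?_⟩
      simp [Fin.sum_univ_succ]
    · refine mem_of_C_mul_mem h_infty (mem_idealOf.2 ⟨![0, 0, 0, C t₀ * X 1, X 1 - X 0 - X 3 + X
        4, 0, 0], ?_⟩)
      simp [Fin.sum_univ_succ] <;> ring
  · exact mem_of_vanishes_two_conic h_one h_infty hc h2
  · exact mem_of_vanishes_one_ten (residual_vanishes (σ := line1) (fun i => by fin_cases i <;>
        simp [line1]) h1 (fun e => absurd (congrArg (eval ![1, 2, 4, 8, 16, 32, 64]) e) (by simp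
            [line1] <;> norm_num)) hg) (residual_vanishes (σ := line10) (fun i => by
        fin_cases i <;> simp [line10]) h10 (fun e => absurd (congrArg (eval ![1, 2, 4, 8, 16, 32,
            64]) e) (by simp [line10] <;> norm_num)) hg)

theorem mem_of_vanishes_five_eleven {f : CoordRing}
    (h5 : bind₁ line5 f = 0) (h11 : bind₁ line11 f = 0) :
    f ∈ idealOf ![X 6, X 0, X 1, X 3 - X 4, X 3 * (X 2 - X 3 + X 5)] := by
  refine mem_idealOf_of_residual
    ![X 0, X 1, X 3, X 4, X 6]
    ![X 0, X 1, X 6, X 3 - X 4, X 2 - X 4 + X 5]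
    (X 3) ?_ ?_ ?_ fun g hg => ?_
  · exact fun i => mem_idealOf.2 ⟨(![![0, 0, 1, 0, 0, 0], ![0, 0, 0, 1, 0, 0], ![1, 0, 0, 0, 0,
      0], ![1, 0, 0, 0, -1, 0], ![0, 1, 0, 0, 0, 0]] : Fin 5 → Fin 6 → CoordRing) i, by fin_cases
      i <;> simp [Fin.sum_univ_succ]⟩
  · exact fun i => mem_idealOf.2 ⟨(![![0, X 3, 0, 0, 0], ![0, 0, X 3, 0, 0], ![X 3, 0, 0, 0, 0],
      ![0, 0, 0, X 3, 0], ![0, 0, 0, X 3, 1]] : Fin 5 → Fin 5 → CoordRing) i, by fin_cases i <;>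
      simp [Fin.sum_univ_succ] <;> ring⟩
  · refine mem_of_bind₁_eq_zero (σ := line11) (fun i => mem_idealOf.2 ⟨(![![1, 0, 0, 0, 0], ![0,
        1, 0, 0, 0], ![0, 0, 0, 0, 0], ![0, 0, 1, 0, 0], ![0, 0, 0, 1, 0], ![0, 0, 0, 0, 0], ![0,
        0, 0, 0, 1]] : Fin 7 → Fin 5 → CoordRing) i, ?_⟩) h11
    fin_cases i <;> simp [Fin.sum_univ_succ, line11]
  · refine mem_of_bind₁_eq_zero (σ := line5) (fun i => mem_idealOf.2 ⟨(![![1, 0, 0, 0, 0], ![0, 1,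
        0, 0, 0], ![0, 0, 0, -1, 1], ![0, 0, 0, 0, 0], ![0, 0, 0, -1, 0], ![0, 0, 0, 0, 0], ![0,
        0, 1, 0, 0]] : Fin 7 → Fin 5 → CoordRing) i, ?_⟩) (residual_vanishes (σ := line5) (fun i
        => by fin_cases i <;> simp [line5]) h5 (fun e => absurd (congrArg (eval ![1, 2, 4, 8, 16,
            32, 64]) e) (by simp [line5])) hg)
    fin_cases i <;> simp [Fin.sum_univ_succ, line5] <;> ring

theorem mem_of_vanishes_hyperplane_section {t₀ t₁ : ℂ} (h_one : t₀ ≠ t₁) (h_infty : t₁ ≠ 0) {f :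
    CoordRing}
    (hc : ∀ y, OnConic t₀ t₁ y → eval y f = 0) (h1 : bind₁ line1 f = 0) (h2 : bind₁ line2 f = 0)
    (h5 : bind₁ line5 f = 0) (h10 : bind₁ line10 f = 0) (h11 : bind₁ line11 f = 0) :
    f ∈ idealOf ![X 6, X 0 * X 5, X 1 * X 5, (X 3 - X 4) * X 5, X 2 * (X 1 - X 0 - X 3 + X 4), X 3
        * (X 1 - X 0 -
      X 3 + X 4), C t₁ * X 0 * X 4 - C t₀ * X 1 * X 3, (C t₀ - C t₁) * X 1 * X 3 + C t₁ * X 2 * (X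
      3 - X 4), C t₀ * X 2 * X 3 - C t₁ * X 2 * X 4 - (C t₀ - C t₁) * X 3 * X 4 + (C t₀ - C t₁) *
      X 3 * X 5] := by
  refine mem_idealOf_of_residual
    ![X 5, X 6, X 2 * (X 1 - X 0 - X 3 + X 4), X 3 * (X 1 - X 0 - X 3 + X 4), C t₁ * X 0 * X 4 - C
      t₀ * X 1 * X 3, (C t₀ - C t₁) * X 1 * X 3 + C t₁ * X 2 * (X 3 - X 4), C t₀ * X 2 * X 3 - C
      t₁ * X 2 * X 4 - (C t₀ - C t₁) * X 3 * X 4]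
    ![X 6, X 0, X 1, X 3 - X 4, X 3 * (X 2 - X 3 + X 5)]
    (X 5) ?_ ?_ ?_ fun g hg => ?_
  · exact fun i => mem_idealOf.2 ⟨(![![1, 0, 0, 0, 0, 0, 0, 0, 0, 0], ![0, 1, 0, 0, 0, 0, 0, 0, 0,
      0], ![0, 0, 0, 0, 0, 1, 0, 0, 0, 0], ![0, 0, 0, 0, 0, 0, 1, 0, 0, 0], ![0, 0, 0, 0, 0, 0, 0,
      1, 0, 0], ![0, 0, 0, 0, 0, 0, 0, 0, 1, 0], ![-((C t₀ - C t₁) * X 3), 0, 0, 0, 0, 0, 0, 0, 0,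
      1]] : Fin 7 → Fin 10 → CoordRing) i, by fin_cases i <;> simp [Fin.sum_univ_succ]⟩
  · intro i
    fin_cases i
    · refine mem_idealOf.2 ⟨![X 5, 0, 0, 0, 0, 0, 0, 0, 0], ?_⟩
      simp [Fin.sum_univ_succ]
    · refine mem_idealOf.2 ⟨![0, 1, 0, 0, 0, 0, 0, 0, 0], ?_⟩
      simp [Fin.sum_univ_succ] <;> ring
    · refine mem_idealOf.2 ⟨![0, 0, 1, 0, 0, 0, 0, 0, 0], ?_⟩
      simp [Fin.sum_univ_succ] <;> ring
    · refine mem_idealOf.2 ⟨![0, 0, 0, 1, 0, 0, 0, 0, 0], ?_⟩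
      simp [Fin.sum_univ_succ] <;> ring
    · refine mem_of_C_mul_mem (sub_ne_zero.2 h_one) (mem_idealOf.2 ⟨![0, 0, 0, -(C t₁ * X 2 + (C
        t₀ - C t₁) * X 3), 0, 0, 0, 0, X 5], ?_⟩)
      simp [Fin.sum_univ_succ] <;> ring
  · exact mem_of_vanishes_one_two_ten_conic h_one h_infty hc h1 h2 h10
  · exact mem_of_vanishes_five_eleven (residual_vanishes (σ := line5) (fun i => by fin_cases i <;>
        simp [line5] <;> ring) h5 (fun e => absurd (congrArg (eval ![1, 2, 4, 8, 16, 32, 64]) e)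
            (by simp [line5])) hg) (residual_vanishes (σ := line11) (fun i => by
        fin_cases i <;> simp [line11]) h11 (fun e => absurd (congrArg (eval ![1, 2, 4, 8, 16, 32,
            64]) e) (by simp [line11])) hg)

/-- The last residuation, with h = X 6: A is the union of the six components in the hyperplane, and
B is the pentagon. -/
theorem mem_of_vanishes_curve {t₀ t₁ : ℂ} (h_one : t₀ ≠ t₁) (h_infty : t₁ ≠ 0) {f : CoordRing}
    (hc : ∀ y, OnConic t₀ t₁ y → eval y f = 0) (h0 : bind₁ line0 f = 0) (h1 : bind₁ line1 f = 0)
    (h2 : bind₁ line2 f = 0) (h5 : bind₁ line5 f = 0) (h6 : bind₁ line6 f = 0) (h7 : bind₁ line7 f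
    = 0) (h8 : bind₁ line8 f = 0) (h9 : bind₁ line9 f = 0) (h10 : bind₁ line10 f = 0) (h11 : bind₁
    line11 f = 0) :
    f ∈ idealOf (quadric t₀ t₁) := by
  refine mem_idealOf_of_residual
    ![X 6, X 0 * X 5, X 1 * X 5, (X 3 - X 4) * X 5, X 2 * (X 1 - X 0 - X 3 + X 4), X 3 * (X 1 - X
      0 - X 3 + X 4), C t₁ * X 0 * X 4 - C t₀ * X 1 * X 3, (C t₀ - C t₁) * X 1 * X 3 + C t₁ * X 2
      * (X 3 - X 4), C t₀ * X 2 * X 3 - C t₁ * X 2 * X 4 - (C t₀ - C t₁) * X 3 * X 4 + (C t₀ - C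
      t₁) * X 3 * X 5]
    ![X 1, X 2, X 0 * X 5, X 0 * X 4, X 3 * (X 4 - X 5), X 3 * X 5 - X 4 * X 5 + X 4 * X 6, X 3 *
      (X 3 + X 0 - X 4 + X 6)]
    (X 6) ?_ ?_ ?_ fun g hg => ?_
  · intro i
    fin_cases i
    · refine mem_idealOf.2 ⟨![1, 0, 0, 0, 0, 0, 0, 0, 0, 0, 0], ?_⟩
      simp [Fin.sum_univ_succ, quadric]
    · refine mem_idealOf.2 ⟨![0, 0, 0, 0, 0, 0, 0, 0, 1, 0, -1], ?_⟩
      simp [Fin.sum_univ_succ, quadric]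
    · refine mem_idealOf.2 ⟨![0, 0, 0, 0, 0, 0, 0, 1, 0, 0, 0], ?_⟩
      simp [Fin.sum_univ_succ, quadric]
    · refine mem_idealOf.2 ⟨![-X 4, 0, 0, 0, 0, 0, 0, 0, 0, 0, 1], ?_⟩
      simp [Fin.sum_univ_succ, quadric] <;> ring
    · refine mem_of_C_mul_mem h_infty (mem_idealOf.2 ⟨![0, 0, 0, 0, 0, 1, 0, 0, 0, 0, 0], ?_⟩)
      simp [Fin.sum_univ_succ, quadric] <;> ring
    · refine mem_of_C_mul_mem (sub_ne_zero.2 h_one) (mem_idealOf.2 ⟨![(C t₀ - C t₁) * X 3, 0, 1,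
        1, 0, 0, 0, 0, 0, 0, 0], ?_⟩)
      simp [Fin.sum_univ_succ, quadric] <;> ring
    · refine mem_idealOf.2 ⟨![0, 1, 0, 0, 0, 0, 0, 0, 0, 0, 0], ?_⟩
      simp [Fin.sum_univ_succ, quadric] <;> ring
    · refine mem_idealOf.2 ⟨![0, 0, 0, 1, 0, 0, 0, 0, 0, 0, 0], ?_⟩
      simp [Fin.sum_univ_succ, quadric] <;> ring
    · refine mem_idealOf.2 ⟨![0, 0, 0, 0, 1, 0, 0, 0, 0, 0, 0], ?_⟩
      simp [Fin.sum_univ_succ, quadric]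
  · intro i
    fin_cases i
    · refine mem_idealOf.2 ⟨![0, 0, 0, 0, 0, 0, 0, 0, 1, 0], ?_⟩
      simp [Fin.sum_univ_succ, quadric] <;> ring
    · refine mem_idealOf.2 ⟨![0, 0, 0, 0, 0, 1, 0, 0, 0, 0], ?_⟩
      simp [Fin.sum_univ_succ, quadric] <;> ring
    · refine mem_idealOf.2 ⟨![0, 0, 0, 0, 0, 0, 0, X 6, 0, -X 6], ?_⟩
      simp [Fin.sum_univ_succ, quadric] <;> ring
    · refine mem_of_C_mul_mem h_infty (mem_idealOf.2 ⟨![X 6, 0, 0, 0, 0, 0, 0, 0, C t₀ * X 3, 0],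
        ?_⟩)
      simp [Fin.sum_univ_succ, quadric] <;> ring
    · refine mem_of_C_mul_mem (sub_ne_zero.2 h_one) (mem_idealOf.2 ⟨![0, 0, 0, -X 6, 0, C t₀ * X 3
        - C t₁ * X 4, 0, 0, 0, 0], ?_⟩)
      simp [Fin.sum_univ_succ, quadric] <;> ring
    · refine mem_idealOf.2 ⟨![0, 0, 0, 0, 0, 0, 0, 0, 0, X 6], ?_⟩
      simp [Fin.sum_univ_succ, quadric]
    · refine mem_of_C_mul_mem (sub_ne_zero.2 h_one) (mem_idealOf.2 ⟨![0, -X 6, -X 6, 0, 0, 0, 0,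
        0, (C t₀ - C t₁) * X 3, 0], ?_⟩)
      simp [Fin.sum_univ_succ, quadric] <;> ring
  · exact mem_of_vanishes_hyperplane_section h_one h_infty hc h1 h2 h5 h10 h11
  · exact mem_of_vanishes_pentagon (residual_vanishes (σ := line0) (fun i => by fin_cases i <;>
        simp [line0, quadric]) h0 (fun e => absurd (congrArg (eval ![1, 2, 4, 8, 16, 32, 64]) e)
            (by simp [line0])) hg) (residual_vanishes (σ := line6) (fun i =>
        by fin_cases i <;> simp [line6, quadric] <;> ring) h6 (fun e => absurd (congrArg (eval ![1,
            2, 4, 8, 16, 32, 64]) e) (by simp [line6])) hg) (residual_vanishes (σ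
        := line7) (fun i => by fin_cases i <;> simp [line7, quadric]) h7 (fun e => absurd (congrArg
            (eval ![1, 2, 4, 8, 16, 32, 64]) e) (by simp [line7])) hg)
        (residual_vanishes (σ := line8) (fun i => by fin_cases i <;> simp [line8, quadric]) h8 (fun
            e => absurd (congrArg (eval ![1, 2, 4, 8, 16, 32, 64]) e) (by simp [line8])) hg)
            (residual_vanishes (σ := line9) (fun i => by fin_cases i <;> simp
        [line9, quadric] <;> ring) h9 (fun e => absurd (congrArg (eval ![1, 2, 4, 8, 16, 32, 64])
            e) (by simp [line9])) hg)

/-! ### Ideals of cones -/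

theorem mem_homIdeal {n : ℕ} {Z : Set (PSpace n)} {f : MvPolynomial (Fin n) ℂ} :
    f ∈ homIdeal Z ↔ ∀ v ∈ affineCone Z, eval v f = 0 := by
  simp [homIdeal, mem_vanishingIdeal_iff, aeval_eq_eval]

theorem homIdeal_anti {n : ℕ} {Y Z : Set (PSpace n)} (h : Y ⊆ Z) : homIdeal Z ≤ homIdeal Y :=
  fun _ hf => mem_homIdeal.2 fun v hv => mem_homIdeal.1 hf v fun hv0 => h (hv hv0)

theorem quadricValue_smul (t₀ t₁ a : ℂ) (y : Fin 7 → ℂ) :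
    quadricValue t₀ t₁ (a • y) = a ^ 2 • quadricValue t₀ t₁ y := by
  rw [quadricValue_eq, quadricValue_eq]
  simp only [Pi.smul_apply, smul_eq_mul, Matrix.smul_cons, Matrix.smul_empty]
  iterate 10 refine Matrix.vecCons_inj.2 ⟨by ring, ?_⟩
  rfl

theorem mem_nodalCurve_iff {t₀ t₁ : ℂ} (h_one : t₀ ≠ t₁) (h_infty : t₁ ≠ 0) {p : PSpace 7} :
    p ∈ nodalCurve t₀ t₁ ↔ quadricValue t₀ t₁ p.rep = 0 := by
  rw [nodalCurve, Set.mem_iUnion]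
  exact ⟨fun ⟨v, hv⟩ => quadricValue_eq_zero_of_component v hv,
    fun h => exists_component_of_quadricValue_eq_zero h_one h_infty h⟩

theorem mk_mem_nodalCurve_iff {t₀ t₁ : ℂ} (h_one : t₀ ≠ t₁) (h_infty : t₁ ≠ 0) {y : Fin 7 → ℂ}
    (hy : y ≠ 0) :
    Projectivization.mk ℂ y hy ∈ nodalCurve t₀ t₁ ↔ quadricValue t₀ t₁ y = 0 := by
  obtain ⟨a, ha⟩ := Projectivization.exists_smul_eq_mk_rep ℂ y hy
  rw [mem_nodalCurve_iff h_one h_infty, ← ha, Units.smul_def, quadricValue_smul]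
  simp

theorem mem_affineCone_nodalCurve_iff {t₀ t₁ : ℂ} (h_one : t₀ ≠ t₁) (h_infty : t₁ ≠ 0)
    {y : Fin 7 → ℂ} : y ∈ affineCone (nodalCurve t₀ t₁) ↔ quadricValue t₀ t₁ y = 0 := by
  by_cases hy : y = 0
  · subst hy
    have h : quadricValue t₀ t₁ 0 = 0 := by simpa using quadricValue_smul t₀ t₁ 0 0
    simp [affineCone, h]
  · simp [affineCone, hy, mk_mem_nodalCurve_iff h_one h_infty]

theorem homIdeal_nodalCurve {t₀ t₁ : ℂ} (h_one : t₀ ≠ t₁) (h_infty : t₁ ≠ 0) :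
    homIdeal (nodalCurve t₀ t₁) = idealOf (quadric t₀ t₁) := by
  refine le_antisymm (fun f hf => ?_) (idealOf_le fun j => mem_homIdeal.2 fun y hy =>
    congrFun ((mem_affineCone_nodalCurve_iff h_one h_infty).1 hy) j)
  have h : ∀ (v : Fin 11) (y : Fin 7 → ℂ), (∀ e ∈ componentEqs t₀ t₁ v, eval y e = 0) →
      eval y f = 0 := fun v y hy => mem_homIdeal.1 hf y
    ((mem_affineCone_nodalCurve_iff h_one h_infty).2 (quadricValue_eq_zero_of_component v hy))
  refine mem_of_vanishes_curve h_one h_infty (fun y ⟨h5, h6, h1, h0, hq⟩ => h 3 y ?_)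
    (bind₁_eq_zero fun y => h 0 _ ?_) (bind₁_eq_zero fun y => h 1 _ ?_)
    (bind₁_eq_zero fun y => h 2 _ ?_) (bind₁_eq_zero fun y => h 4 _ ?_)
    (bind₁_eq_zero fun y => h 5 _ ?_) (bind₁_eq_zero fun y => h 6 _ ?_)
    (bind₁_eq_zero fun y => h 7 _ ?_) (bind₁_eq_zero fun y => h 8 _ ?_)
    (bind₁_eq_zero fun y => h 9 _ ?_) (bind₁_eq_zero fun y => h 10 _ ?_)
  · simp [componentEqs, h5, h6, h1, h0]
    linear_combination hq
  · simp [componentEqs, line0]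
  · simp [componentEqs, line1]
  · simp [componentEqs, line2]
  · simp [componentEqs, line5]
  · simp [componentEqs, line6]
  · simp [componentEqs, line7]
  · simp [componentEqs, line8]
  · simp [componentEqs, line9]
  · simp [componentEqs, line10]
  · simp [componentEqs, line11]

/-! ### The Jacobian matrix -/

/-- The Jacobian matrix of the quadrics. -/
def jacobian (t₀ t₁ : ℂ) (y : Fin 7 → ℂ) : Matrix (Fin 7) (Fin 10) ℂ :=
  Matrix.of fun i j => eval y (pderiv i (quadric t₀ t₁ j))

/-- The polar forms of the quadrics. -/
def quadricPolar (t₀ t₁ : ℂ) (y z : Fin 7 → ℂ) : QSpace :=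
  ![-t₀ * (y 1 * z 3 + y 3 * z 1) + t₁ * (y 0 * z 4 + y 4 * z 0),
    -(t₀ - t₁) * (y 0 * z 3 + y 3 * z 0) - t₁ * (y 2 * z 3 + y 3 * z 2)
      - (t₀ - t₁) * (2 * y 3 * z 3) + t₁ * (y 2 * z 4 + y 4 * z 2)
      + (t₀ - t₁) * (y 3 * z 4 + y 4 * z 3) - (t₀ - t₁) * (y 3 * z 6 + y 6 * z 3),
    (t₀ - t₁) * (y 1 * z 3 + y 3 * z 1) + t₁ * (y 2 * z 3 + y 3 * z 2)
      - t₁ * (y 2 * z 4 + y 4 * z 2),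
    t₀ * (y 2 * z 3 + y 3 * z 2) - t₁ * (y 2 * z 4 + y 4 * z 2)
      - (t₀ - t₁) * (y 3 * z 4 + y 4 * z 3) + (t₀ - t₁) * (y 3 * z 5 + y 5 * z 3),
    -t₁ * (y 0 * z 2 + y 2 * z 0) + t₁ * (y 1 * z 2 + y 2 * z 1) - t₁ * (y 2 * z 3 + y 3 * z 2)
      + t₁ * (y 2 * z 4 + y 4 * z 2),
    y 2 * z 6 + y 6 * z 2,
    y 1 * z 5 + y 5 * z 1,
    (y 0 * z 5 + y 5 * z 0) + (y 3 * z 5 + y 5 * z 3) - (y 4 * z 5 + y 5 * z 4)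
      + (y 4 * z 6 + y 6 * z 4),
    y 1 * z 6 + y 6 * z 1,
    (y 3 * z 5 + y 5 * z 3) - (y 4 * z 5 + y 5 * z 4) + (y 4 * z 6 + y 6 * z 4)]

theorem vectorForm_spinorLift_polar (t₀ t₁ : ℂ) (y z : Fin 7 → ℂ) :
    vectorForm (spinorLift t₀ t₁ y) (spinorLift t₀ t₁ z) = (-t₁) • quadricPolar t₀ t₁ y z := by
  rw [quadricPolar, spinorLift_apply, spinorLift_apply]
  simp only [vectorForm, Matrix.cons_val, Matrix.smul_cons, Matrix.smul_empty, smul_eq_mul]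
  iterate 10 refine Matrix.vecCons_inj.2 ⟨by ring, ?_⟩
  rfl

theorem jacobian_row (t₀ t₁ : ℂ) (y : Fin 7 → ℂ) (i : Fin 7) :
    (jacobian t₀ t₁ y).row i = quadricPolar t₀ t₁ y (Pi.single i 1) := by
  have h : ∀ k, eval y (pderiv i (X k)) = (Pi.single i 1 : Fin 7 → ℂ) k := fun k => by
    rw [pderiv_X, Pi.single_apply, Pi.single_apply]
    split_ifs <;> simp
  ext j
  change eval y (pderiv i (quadric t₀ t₁ j)) = _
  -- Only the values of the partial derivatives of the variables matter, so one computation with a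
  -- formal direction z serves all rows.
  generalize (Pi.single i 1 : Fin 7 → ℂ) = z at h
  fin_cases j <;>
    simp [-pderiv_X, quadric, quadricPolar, h] <;> ring

theorem jacobianRowSpace_eq (t₀ t₁ : ℂ) (p : PSpace 7) :
    jacobianRowSpace t₀ t₁ p = Submodule.span ℂ (Set.range (jacobian t₀ t₁ p.rep).row) := rfl

/-- The rows are multiples of β(L p, L eᵢ), and q(L p) = 0 on the curve, so
`vectorForm_mem_annihilator` applies. -/
theorem jacobianRowSpace_le_annihilator {t₀ t₁ : ℂ} (h_one : t₀ ≠ t₁) (h_infty : t₁ ≠ 0)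
    {p : PSpace 7} (hp : p ∈ nodalCurve t₀ t₁) :
    jacobianRowSpace t₀ t₁ p ≤ annihilator (spinorLift t₀ t₁ p.rep) := by
  rw [jacobianRowSpace_eq, Submodule.span_le]
  rintro _ ⟨i, rfl⟩
  have h0 : vectorForm (spinorLift t₀ t₁ p.rep) (spinorLift t₀ t₁ p.rep) = 0 := by
    rw [vectorForm_spinorLift, (mem_nodalCurve_iff h_one h_infty).1 hp, smul_zero]
  have h := vectorForm_mem_annihilator h0 (spinorLift t₀ t₁ (Pi.single i 1))
  rw [vectorForm_spinorLift_polar, ← jacobian_row] at h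
  exact ((annihilator _).smul_mem_iff (neg_ne_zero.2 h_infty)).1 h

/-- The quadrics generate the ideal and vanish at p, so by the Leibniz rule the differential at p of
any element of the ideal is a combination of theirs. -/
theorem coneTangentSpace_nodalCurve {t₀ t₁ : ℂ} (h_one : t₀ ≠ t₁) (h_infty : t₁ ≠ 0)
    {p : PSpace 7} (hp : p ∈ nodalCurve t₀ t₁) : coneTangentSpace (nodalCurve t₀ t₁) p =
      LinearMap.ker (jacobian t₀ t₁ p.rep).transpose.mulVecLin := by
  ext w
  have h : w ∈ LinearMap.ker (jacobian t₀ t₁ p.rep).transpose.mulVecLin ↔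
      ∀ j, ∑ i, eval p.rep (pderiv i (quadric t₀ t₁ j)) * w i = 0 := by
    rw [LinearMap.mem_ker, funext_iff]
    rfl
  rw [h]
  change (∀ f ∈ homIdeal (nodalCurve t₀ t₁), _) ↔ _
  rw [homIdeal_nodalCurve h_one h_infty]
  refine ⟨fun hw j => hw _ (Ideal.subset_span ⟨j, rfl⟩), fun hw f hf => ?_⟩
  obtain ⟨c, rfl⟩ := mem_idealOf.1 hf
  have hg : ∀ j, eval p.rep (quadric t₀ t₁ j) = 0 :=
    congrFun ((mem_nodalCurve_iff h_one h_infty).1 hp)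
  have h1 : ∀ i, eval p.rep (pderiv i (∑ j, c j * quadric t₀ t₁ j)) =
      ∑ j, eval p.rep (c j) * eval p.rep (pderiv i (quadric t₀ t₁ j)) := by
    intro i
    rw [map_sum, map_sum]
    refine Finset.sum_congr rfl fun j _ => ?_
    rw [Derivation.leibniz, map_add, smul_eq_mul, smul_eq_mul, map_mul, map_mul, hg, zero_mul,
      add_zero]
  simp only [h1, Finset.sum_mul]
  rw [Finset.sum_comm]
  refine Finset.sum_eq_zero fun j _ => ?_
  simp only [mul_assoc]
  rw [← Finset.mul_sum, hw j, mul_zero]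

theorem spinorLift_ne_zero {t₀ t₁ : ℂ} (h_one : t₀ ≠ t₁) (h_infty : t₁ ≠ 0) {y : Fin 7 → ℂ}
    (hy : y ≠ 0) : spinorLift t₀ t₁ y ≠ 0 :=
  (map_ne_zero_iff _ (spinorLift_injective h_one h_infty)).2 hy

theorem isLagrangian_jacobianRowSpace {t₀ t₁ : ℂ} (h_one : t₀ ≠ t₁) (h_infty : t₁ ≠ 0)
    {p : PSpace 7} (hp : p ∈ smoothLocus (nodalCurve t₀ t₁)) :
    IsLagrangian (jacobianRowSpace t₀ t₁ p) := by
  refine ⟨?_, fun u hu => quadForm_eq_zero_of_mem_annihilator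
    (spinorLift_ne_zero h_one h_infty p.rep_nonzero)
    (jacobianRowSpace_le_annihilator h_one h_infty hp.1 hu)⟩
  have h1 := hp.2
  rw [coneTangentSpace_nodalCurve h_one h_infty hp.1] at h1
  have h2 := LinearMap.finrank_range_add_finrank_ker (jacobian t₀ t₁ p.rep).transpose.mulVecLin
  have h3 : Module.finrank ℂ (LinearMap.range (jacobian t₀ t₁ p.rep).transpose.mulVecLin) =
    Module.finrank ℂ (jacobianRowSpace t₀ t₁ p) := by
    rw [jacobianRowSpace_eq, ← Matrix.rank_eq_finrank_span_row, ← Matrix.rank_transpose]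
    rfl
  rw [h1, h3, Module.finrank_fin_fun] at h2
  omega

/-! ### Linear maps between projective spaces -/

/-- The forms of degree one that define a linear map. -/
def linForm {n m : ℕ} (A : (Fin n → ℂ) →ₗ[ℂ] (Fin m → ℂ)) (i : Fin m) : MvPolynomial (Fin n) ℂ :=
  ∑ j, C (A (Pi.single j 1) i) * X j

theorem eval_linForm {n m : ℕ} (A : (Fin n → ℂ) →ₗ[ℂ] (Fin m → ℂ)) (i : Fin m) (x : Fin n → ℂ) :
    eval x (linForm A i) = A x i := by
  rw [eq_sum_smul_single A A.map_add A.map_smul x]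
  simp only [linForm, map_sum, map_mul, eval_C, eval_X, Finset.sum_apply, Pi.smul_apply,
    smul_eq_mul, mul_comm]

theorem isHomogeneous_linForm {n m : ℕ} (A : (Fin n → ℂ) →ₗ[ℂ] (Fin m → ℂ)) (i : Fin m) :
    (linForm A i).IsHomogeneous 1 :=
  IsHomogeneous.sum _ _ _ fun j _ => by
    simpa only [zero_add] using (isHomogeneous_C (Fin n) (A (Pi.single j 1) i)).mul
      (isHomogeneous_X ℂ j)

theorem eval_bind₁_linForm {n m : ℕ} (A : (Fin n → ℂ) →ₗ[ℂ] (Fin m → ℂ))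
    (f : MvPolynomial (Fin m) ℂ) (x : Fin n → ℂ) : eval x (bind₁ (linForm A) f) = eval (A x) f := by
  have h : A x = fun i => eval x (linForm A i) := funext fun i => (eval_linForm A i x).symm
  rw [h]
  exact eval₂Hom_bind₁ _ _ _ _

theorem map_mk_of_ne_zero {n m : ℕ} {A : (Fin n → ℂ) →ₗ[ℂ] (Fin m → ℂ)}
    (hA : Function.Injective A) {y : Fin n → ℂ} (hy : y ≠ 0) (hAy : A y ≠ 0) :
    Projectivization.map A hA (Projectivization.mk ℂ y hy) = Projectivization.mk ℂ (A y) hAy :=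
  Projectivization.map_mk _ _ _ _

/-! ### The spinor map -/

/-- The quadratic equations of the orthogonal Grassmannian. -/
def spinorQuadric : Fin 10 → MvPolynomial (Fin 16) ℂ :=
  ![X 6 * X 9 - X 7 * X 8 + X 0 * X 15 - X 5 * X 10,
    X 4 * X 8 - X 3 * X 9 + X 2 * X 10 - X 0 * X 14,
    X 3 * X 7 - X 4 * X 6 + X 0 * X 13 - X 1 * X 10,
    X 4 * X 5 - X 2 * X 7 + X 1 * X 9 - X 0 * X 12,
    X 2 * X 6 - X 3 * X 5 + X 0 * X 11 - X 1 * X 8,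
    X 4 * X 11 - X 3 * X 12 + X 2 * X 13 - X 1 * X 14,
    X 7 * X 11 - X 6 * X 12 + X 5 * X 13 - X 1 * X 15,
    X 9 * X 11 - X 8 * X 12 + X 5 * X 14 - X 2 * X 15,
    X 10 * X 11 - X 8 * X 13 + X 6 * X 14 - X 3 * X 15,
    X 10 * X 12 - X 9 * X 13 + X 7 * X 14 - X 4 * X 15]

theorem isHomogeneous_spinorQuadric (j : Fin 10) : (spinorQuadric j).IsHomogeneous 2 := by
  have h : ∀ a b : Fin 16, (X a * X b : MvPolynomial (Fin 16) ℂ).IsHomogeneous 2 :=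
    fun a b => (isHomogeneous_X _ a).mul (isHomogeneous_X _ b)
  fin_cases j <;> exact (((h _ _).sub (h _ _)).add (h _ _)).sub (h _ _)

theorem two_mul_eval_spinorQuadric (x : Fin 16 → ℂ) (j : Fin 10) :
    2 * eval x (spinorQuadric j) = vectorForm x x j := by
  fin_cases j <;> simp [spinorQuadric, vectorForm] <;> ring

theorem eval_spinorQuadric_eq_zero_iff (x : Fin 16 → ℂ) :
    (∀ j, eval x (spinorQuadric j) = 0) ↔ vectorForm x x = 0 := by
  simp [funext_iff, ← two_mul_eval_spinorQuadric]

theorem mk_mem_spinorPlane_iff {t₀ t₁ : ℂ} (h_infty : t₁ ≠ 0) {x : Fin 16 → ℂ} (hx : x ≠ 0) :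
    Projectivization.mk ℂ x hx ∈ spinorPlane t₀ t₁ ↔ ∃ y, spinorLift t₀ t₁ y = x := by
  rw [spinorPlane, ← range_spinorLift h_infty]
  rfl

theorem mem_affineCone_spinorPlane {t₀ t₁ : ℂ} (h_infty : t₁ ≠ 0) {x : Fin 16 → ℂ}
    (hx : x ∈ affineCone (spinorPlane t₀ t₁)) : ∃ y, spinorLift t₀ t₁ y = x := by
  by_cases h : x = 0
  · exact ⟨0, by rw [h, map_zero]⟩
  · exact (mk_mem_spinorPlane_iff h_infty h).1 (hx h)

theorem vectorForm_eq_zero_of_mem_affineCone {x : Fin 16 → ℂ} (hx : x ∈ affineCone OG) :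
    vectorForm x x = 0 := by
  by_cases h : x = 0
  · rw [h]; simpa using vectorForm_smul_smul 0 0
  · exact (mk_mem_OG_iff h).1 (hx h)

/-- The spinor map. -/
def spinorMap {t₀ t₁ : ℂ} (h_one : t₀ ≠ t₁) (h_infty : t₁ ≠ 0) : PSpace 7 → PSpace 16 :=
  Projectivization.map (spinorLift t₀ t₁) (spinorLift_injective h_one h_infty)

theorem spinorMap_mk {t₀ t₁ : ℂ} (h_one : t₀ ≠ t₁) (h_infty : t₁ ≠ 0) {y : Fin 7 → ℂ} (hy : y ≠ 0) :
    spinorMap h_one h_infty (Projectivization.mk ℂ y hy) =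
      Projectivization.mk ℂ (spinorLift t₀ t₁ y) (spinorLift_ne_zero h_one h_infty hy) :=
  map_mk_of_ne_zero _ _ _

theorem spinorMap_eq {t₀ t₁ : ℂ} (h_one : t₀ ≠ t₁) (h_infty : t₁ ≠ 0) (p : PSpace 7) :
    spinorMap h_one h_infty p = Projectivization.mk ℂ (spinorLift t₀ t₁ p.rep)
      (spinorLift_ne_zero h_one h_infty p.rep_nonzero) := by
  conv_lhs => rw [← p.mk_rep]
  exact spinorMap_mk _ _ _

theorem exists_rep_spinorMap {t₀ t₁ : ℂ} (h_one : t₀ ≠ t₁) (h_infty : t₁ ≠ 0) (p : PSpace 7) :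
    ∃ a : ℂ, a ≠ 0 ∧ (spinorMap h_one h_infty p).rep = a • spinorLift t₀ t₁ p.rep := by
  rw [spinorMap_eq]
  obtain ⟨a, ha⟩ := Projectivization.exists_smul_eq_mk_rep ℂ (spinorLift t₀ t₁ p.rep)
    (spinorLift_ne_zero h_one h_infty p.rep_nonzero)
  exact ⟨a, a.ne_zero, ha.symm⟩

theorem isHalfSpinor_jacobianRowSpace_iff {t₀ t₁ : ℂ} (h_one : t₀ ≠ t₁) (h_infty : t₁ ≠ 0)
    {p : PSpace 7} (hp : p ∈ smoothLocus (nodalCurve t₀ t₁)) (x : PSpace 16) :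
    IsHalfSpinor (jacobianRowSpace t₀ t₁ p) x ↔ x = spinorMap h_one h_infty p := by
  have hle := jacobianRowSpace_le_annihilator h_one h_infty hp.1
  constructor
  · intro hx
    obtain ⟨a, ha⟩ := (isLagrangian_jacobianRowSpace h_one h_infty hp).exists_smul_eq hx
      (fun u hu => (cliffordAction_evenSpinor_eq_zero_iff _ _).2 (hle hu))
      (spinorLift_ne_zero h_one h_infty p.rep_nonzero)
    rw [spinorMap_eq, ← x.mk_rep, Projectivization.mk_eq_mk_iff']
    exact ⟨a, ha⟩
  · rintro rfl
    obtain ⟨a, -, ha⟩ := exists_rep_spinorMap h_one h_infty p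
    rw [isHalfSpinor_iff, ha]
    intro u hu
    rw [mem_annihilator, evenAction_smul, mem_annihilator.1 (hle hu), smul_zero]

theorem image_spinorMap {t₀ t₁ : ℂ} (h_one : t₀ ≠ t₁) (h_infty : t₁ ≠ 0) :
    spinorMap h_one h_infty '' nodalCurve t₀ t₁ = spinorPlane t₀ t₁ ∩ OG := by
  have key : ∀ {y : Fin 7 → ℂ}, vectorForm (spinorLift t₀ t₁ y) (spinorLift t₀ t₁ y) = 0 ↔
      quadricValue t₀ t₁ y = 0 := fun {y} => by
    rw [vectorForm_spinorLift]
    simp [h_infty]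
  ext x
  induction x using Projectivization.ind with
  | h x hx =>
  rw [Set.mem_inter_iff, mk_mem_spinorPlane_iff h_infty, mk_mem_OG_iff]
  constructor
  · rintro ⟨p, hp, hpx⟩
    rw [spinorMap_eq, Projectivization.mk_eq_mk_iff'] at hpx
    obtain ⟨a, ha⟩ := hpx
    have ha0 : a ≠ 0 := by
      rintro rfl
      rw [zero_smul] at ha
      exact spinorLift_ne_zero h_one h_infty p.rep_nonzero ha.symm
    have hx' : x = spinorLift t₀ t₁ (a⁻¹ • p.rep) := by
      rw [map_smul, ← ha, smul_smul, inv_mul_cancel₀ ha0, one_smul]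
    refine ⟨⟨_, hx'.symm⟩, ?_⟩
    rw [hx', key, quadricValue_smul, (mem_nodalCurve_iff h_one h_infty).1 hp, smul_zero]
  · rintro ⟨⟨y, rfl⟩, hy⟩
    have hy0 : y ≠ 0 := by
      rintro rfl
      exact hx (map_zero _)
    exact ⟨_, (mk_mem_nodalCurve_iff h_one h_infty hy0).2 (key.1 hy), spinorMap_mk _ _ _⟩

theorem isMorphismOn_spinorMap {t₀ t₁ : ℂ} (h_one : t₀ ≠ t₁) (h_infty : t₁ ≠ 0)
    (Z : Set (PSpace 7)) : IsMorphismOn Z (spinorMap h_one h_infty) := by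
  intro p _
  refine ⟨1, linForm (spinorLift t₀ t₁), isHomogeneous_linForm _, ?_, fun q _ hq => ?_⟩
  · simp only [eval_linForm]
    exact spinorLift_ne_zero h_one h_infty p.rep_nonzero
  · simp only [eval_linForm]
    exact spinorMap_eq h_one h_infty q

open Classical in
/-- The linear projection that inverts the spinor map. -/
def inverseSpinorMap (t₀ t₁ : ℂ) (x : PSpace 16) : PSpace 7 :=
  if h : spinorProj t₀ t₁ x.rep ≠ 0 then Projectivization.mk ℂ (spinorProj t₀ t₁ x.rep) h
  -- An arbitrary value, never used on the image of `spinorMap`, where the projection does not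
  -- vanish.
  else Projectivization.mk ℂ (Pi.single 0 1) (by simp)

theorem exists_spinorProj_rep {t₀ t₁ : ℂ} (h_one : t₀ ≠ t₁) (h_infty : t₁ ≠ 0) (p : PSpace 7) :
    ∃ a : ℂ, a ≠ 0 ∧ spinorProj t₀ t₁ (spinorMap h_one h_infty p).rep = a • p.rep := by
  obtain ⟨a, ha0, ha⟩ := exists_rep_spinorMap h_one h_infty p
  exact ⟨a, ha0, by rw [ha, map_smul, spinorProj_spinorLift h_one h_infty]⟩

theorem inverseSpinorMap_spinorMap {t₀ t₁ : ℂ} (h_one : t₀ ≠ t₁) (h_infty : t₁ ≠ 0) (p : PSpace 7) :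
    inverseSpinorMap t₀ t₁ (spinorMap h_one h_infty p) = p := by
  obtain ⟨a, ha0, ha⟩ := exists_spinorProj_rep h_one h_infty p
  have h : spinorProj t₀ t₁ (spinorMap h_one h_infty p).rep ≠ 0 := by
    rw [ha]
    exact smul_ne_zero ha0 p.rep_nonzero
  rw [inverseSpinorMap, dif_pos h]
  conv_rhs => rw [← p.mk_rep]
  rw [Projectivization.mk_eq_mk_iff']
  exact ⟨a, ha.symm⟩

theorem isMorphismOn_inverseSpinorMap {t₀ t₁ : ℂ} (h_one : t₀ ≠ t₁) (h_infty : t₁ ≠ 0)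
    (Z : Set (PSpace 7)) : IsMorphismOn (spinorMap h_one h_infty '' Z) (inverseSpinorMap t₀ t₁) :=
        by
  rintro _ ⟨p, _, rfl⟩
  refine ⟨1, linForm (spinorProj t₀ t₁), isHomogeneous_linForm _, ?_, fun q _ hq => ?_⟩
  · simp only [eval_linForm]
    obtain ⟨a, ha0, ha⟩ := exists_spinorProj_rep h_one h_infty p
    refine ne_of_eq_of_ne ha (smul_ne_zero ha0 p.rep_nonzero)
  · simp only [eval_linForm] at hq ⊢
    exact dif_pos hq

theorem isProjAlgebraic_spinorPlane_inter_OG {t₀ t₁ : ℂ} (h_one : t₀ ≠ t₁) (h_infty : t₁ ≠ 0) :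
    IsProjAlgebraic (spinorPlane t₀ t₁ ∩ OG) := by
  -- The kernel of `A` is the image of `spinorLift`, so its coordinate forms are linear equations of
  -- P_t.
  let A := LinearMap.id - (spinorLift t₀ t₁).comp (spinorProj t₀ t₁)
  refine ⟨Set.range (linForm A) ∪ Set.range spinorQuadric, ?_, ?_⟩
  · rintro _ (⟨i, rfl⟩ | ⟨j, rfl⟩)
    · exact ⟨1, isHomogeneous_linForm A i⟩
    · exact ⟨2, isHomogeneous_spinorQuadric j⟩
  ext x
  have h1 : x ∈ spinorPlane t₀ t₁ ↔ ∀ i, eval x.rep (linForm A i) = 0 := by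
    conv_lhs => rw [← x.mk_rep]
    rw [mk_mem_spinorPlane_iff h_infty]
    simp only [eval_linForm, ← Pi.zero_apply (M := fun _ : Fin 16 => ℂ), ← funext_iff]
    change _ ↔ x.rep - spinorLift t₀ t₁ (spinorProj t₀ t₁ x.rep) = 0
    constructor
    · rintro ⟨y, hy⟩
      rw [← hy, spinorProj_spinorLift h_one h_infty, sub_self]
    · intro h
      exact ⟨_, (sub_eq_zero.1 h).symm⟩
  have h2 : x ∈ OG ↔ ∀ j, eval x.rep (spinorQuadric j) = 0 := by
    conv_lhs => rw [← x.mk_rep]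
    rw [mk_mem_OG_iff, eval_spinorQuadric_eq_zero_iff]
  rw [Set.mem_inter_iff, h1, h2]
  simp only [projZeros, Set.mem_ofPred_eq, Set.mem_union, or_imp, forall_and, Set.forall_mem_range]

/-! ### The scheme-theoretic intersection -/

theorem spinorQuadric_mem_homIdeal (j : Fin 10) : spinorQuadric j ∈ homIdeal OG :=
  mem_homIdeal.2 fun _ hx =>
    (eval_spinorQuadric_eq_zero_iff _).2 (vectorForm_eq_zero_of_mem_affineCone hx) j

/-- On P_t, -t₁ times the pulled back quadric agrees with a quadratic equation of OG. It is enough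
that these equations lie in the ideal of OG; whether they generate it plays no role. -/
theorem bind₁_quadric_mem {t₀ t₁ : ℂ} (h_one : t₀ ≠ t₁) (h_infty : t₁ ≠ 0) (j : Fin 10) :
    bind₁ (linForm (spinorProj t₀ t₁)) (quadric t₀ t₁ j) ∈
      homIdeal (spinorPlane t₀ t₁) ⊔ homIdeal OG := by
  have h1 : C (-t₁) * bind₁ (linForm (spinorProj t₀ t₁)) (quadric t₀ t₁ j) - spinorQuadric j ∈
      homIdeal (spinorPlane t₀ t₁) := by
    refine mem_homIdeal.2 fun x hx => ?_
    obtain ⟨y, rfl⟩ := mem_affineCone_spinorPlane h_infty hx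
    have h2 := two_mul_eval_spinorQuadric (spinorLift t₀ t₁ y) j
    rw [vectorForm_spinorLift] at h2
    have h3 : 2 * eval (spinorLift t₀ t₁ y) (spinorQuadric j) =
      -2 * t₁ * eval y (quadric t₀ t₁ j) := h2
    rw [map_sub, map_mul, eval_bind₁_linForm, spinorProj_spinorLift h_one h_infty, eval_C]
    linear_combination -h3 / 2
  have h4 := Ideal.add_mem (homIdeal (spinorPlane t₀ t₁) ⊔ homIdeal OG) (Ideal.mem_sup_left h1)
    (Ideal.mem_sup_right (spinorQuadric_mem_homIdeal j))
  rw [sub_add_cancel] at h4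
  have h5 := Ideal.mul_mem_left _ (C (-t₁)⁻¹) h4
  rwa [← mul_assoc, ← C_mul, inv_mul_cancel₀ (neg_ne_zero.2 h_infty), C_1, one_mul] at h5

/-- If f vanishes on the image, f ∘ L is a combination of the quadrics. Composing with the
projection puts f ∘ L ∘ π in the sum of ideals, and f - f ∘ L ∘ π vanishes on P_t because π inverts
L there. The other inclusion is formal. -/
theorem homIdeal_image_spinorMap {t₀ t₁ : ℂ} (h_one : t₀ ≠ t₁) (h_infty : t₁ ≠ 0) :
    homIdeal (spinorMap h_one h_infty '' nodalCurve t₀ t₁) =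
      homIdeal (spinorPlane t₀ t₁) ⊔ homIdeal OG := by
  refine le_antisymm (fun f hf => ?_) (sup_le (homIdeal_anti ?_) (homIdeal_anti ?_))
  · have hf' : bind₁ (linForm (spinorLift t₀ t₁)) f ∈ homIdeal (nodalCurve t₀ t₁) := by
      refine mem_homIdeal.2 fun y hy => ?_
      rw [eval_bind₁_linForm]
      refine mem_homIdeal.1 hf _ fun h0 => ?_
      have hy0 : y ≠ 0 := by
        rintro rfl
        exact h0 (map_zero _)
      exact ⟨_, hy hy0, spinorMap_mk _ _ _⟩
    rw [homIdeal_nodalCurve h_one h_infty] at hf'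
    obtain ⟨c, hc⟩ := mem_idealOf.1 hf'
    have h1 : f - bind₁ (linForm (spinorProj t₀ t₁)) (bind₁ (linForm (spinorLift t₀ t₁)) f) ∈
        homIdeal (spinorPlane t₀ t₁) := by
      refine mem_homIdeal.2 fun x hx => ?_
      obtain ⟨y, rfl⟩ := mem_affineCone_spinorPlane h_infty hx
      rw [map_sub, eval_bind₁_linForm, eval_bind₁_linForm, spinorProj_spinorLift h_one h_infty,
        sub_self]
    have h2 : bind₁ (linForm (spinorProj t₀ t₁)) (bind₁ (linForm (spinorLift t₀ t₁)) f) ∈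
        homIdeal (spinorPlane t₀ t₁) ⊔ homIdeal OG := by
      rw [← hc, map_sum]
      refine Ideal.sum_mem _ fun j _ => ?_
      rw [map_mul]
      exact Ideal.mul_mem_left _ _ (bind₁_quadric_mem h_one h_infty j)
    simpa using Ideal.add_mem _ (Ideal.mem_sup_left h1) h2
  · rw [image_spinorMap]
    exact Set.inter_subset_left
  · rw [image_spinorMap]
    exact Set.inter_subset_right

end SpinorCurve

end

theorem mainTheorem6 (t₀ t₁ : ℂ) (h_one : t₀ ≠ t₁) (h_infty : t₁ ≠ 0) :
    (∀ p ∈ SpinorCurve.smoothLocus (SpinorCurve.nodalCurve t₀ t₁),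
      SpinorCurve.IsLagrangian (SpinorCurve.jacobianRowSpace t₀ t₁ p)) ∧
    ∃ ρ : SpinorCurve.PSpace 7 → SpinorCurve.PSpace 16,
      (∀ p ∈ SpinorCurve.smoothLocus (SpinorCurve.nodalCurve t₀ t₁),
        ∀ x : SpinorCurve.PSpace 16,
          SpinorCurve.IsHalfSpinor (SpinorCurve.jacobianRowSpace t₀ t₁ p) x ↔ x = ρ p) ∧
      SpinorCurve.IsEmbeddingOn (SpinorCurve.nodalCurve t₀ t₁) ρ ∧
      Module.finrank ℂ
        (Submodule.span ℂ (Set.range (SpinorCurve.spinorMatrix t₀ t₁).row)) = 7 ∧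
      ρ '' SpinorCurve.nodalCurve t₀ t₁ = SpinorCurve.spinorPlane t₀ t₁ ∩ SpinorCurve.OG ∧
      SpinorCurve.SameSubscheme
        (SpinorCurve.homIdeal (ρ '' SpinorCurve.nodalCurve t₀ t₁))
        (SpinorCurve.homIdeal (SpinorCurve.spinorPlane t₀ t₁) ⊔
          SpinorCurve.homIdeal SpinorCurve.OG) := by
  refine ⟨fun p hp => SpinorCurve.isLagrangian_jacobianRowSpace h_one h_infty hp,
    SpinorCurve.spinorMap h_one h_infty,
    fun p hp x => SpinorCurve.isHalfSpinor_jacobianRowSpace_iff h_one h_infty hp x,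
    ⟨SpinorCurve.isMorphismOn_spinorMap h_one h_infty _, ?_,
      SpinorCurve.inverseSpinorMap t₀ t₁,
      SpinorCurve.isMorphismOn_inverseSpinorMap h_one h_infty _,
      fun p _ => SpinorCurve.inverseSpinorMap_spinorMap h_one h_infty p⟩, ?_,
    SpinorCurve.image_spinorMap h_one h_infty, ?_⟩
  · rw [SpinorCurve.image_spinorMap]
    exact SpinorCurve.isProjAlgebraic_spinorPlane_inter_OG h_one h_infty
  · rw [← SpinorCurve.range_spinorLift h_infty,
      LinearMap.finrank_range_of_inj (SpinorCurve.spinorLift_injective h_one h_infty),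
      Module.finrank_fin_fun]
  -- The two ideals are equal, so their saturations coincide.
  · rw [SpinorCurve.SameSubscheme, SpinorCurve.homIdeal_image_spinorMap]
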